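/- Let $N\ge 0$ and consider a time-slotted network of $N$ switches with one queue $Q_{ij}$ for each ordered pair $i\ne j$; let $L(t)\in\mathbb N^{N\times N}$ be the queue lengths at the beginning of slot $t=0,1,2,\dots$ (zero diagonal), with $L(0)=0$. The set $\mathcal S$ of feasible schedules consists of $\{0,1\}$-matrices with all row and column sums at most $1$ and contains all $N!$ permutation matrices (a non-blocking network). In slot $t$ a schedule $S(t)\in\mathcal S$ is used, where $S(-1)\in\mathcal S$ is a given initial schedule; a reconfiguration occurs at $t$ if $S(t)\neq S(t-1)$. Let $\Delta_r>0$ be the reconfiguration delay. Then $L(t+1)=L(t)-D(t)+A(t)$, where $D_{ij}(t)=0$ if some reconfiguration occurred at a slot $t'$ with $0\le t-t'\le\Delta_r$ or if $L_{ij}(t)=0$, and $D_{ij}(t)=S_{ij}(t)$ otherwise. The arrivals $A_{ij}(t)\in\mathbb N$, $i\neq j$ (with $A_{ii}=0$), are bounded by a constant, independent over the pairs $(i,j)$, and i.i.d. over $t$. A scheduling policy chooses each $S(t)$ as a function of the history $A(0),\dots,A(t),S(0),\dots,S(t-1)$. It strongly stabilizes the network if $\limsup_{t\to\infty}\frac1t\sum_{\tau=0}^{t-1}\mathbb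 E\sum_{i,j}L_{ij}(\tau)<\infty$; the traffic is admissible if some scheduling policy strongly stabilizes the network; a policy is throughput optimal if it strongly stabilizes the network under every admissible traffic. For a schedule $S$ put $W_S(t)=\sum_{i,j}L_{ij}(t)S_{ij}$. Let $H(0),H(1),\dots$ be a Hamiltonian walk on the permutation matrices: each of the $N!$ permutation matrices is visited exactly once in the slots $0,\dots,N!-1$, and $H(t+N!)=H(t)$. The Hamiltonian policy proposes $\Pi_H(t)=\Pi_H(t-1)$ if $W_{\Pi_H(t-1)}(t)\ge W_{H(t)}(t)$ and $\Pi_H(t)=H(t)$ otherwise, where $\Pi_H(-1)\in\mathcal S$ is arbitrary. Let $g:[0,\infty)\to[0,\infty)$ be continuous, strictly increasing, unbounded and sublinear, i.e. $g(x)/x\to0$ as $x\to\infty$. The $g$-adaptive variant of the Hamiltonian policy uses $S(t)=S(t-1)$ if $W_{\Pi_H(t)}(t)-W_{S(t-1)}(t)\le g\big(W_{\Pi_H(t)}(t)\big)$, and $S(t)=\Pi_H(t)$ otherwise. Then, for every $\Delta_r>0$, the $g$-adaptive variant of the Hamiltonian policy is throughput optimal. -/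

import Mathlib

open MeasureTheory ProbabilityTheory Filter Topology
open scoped ENNReal Nat

universe u

/-- `N × N` matrices of natural numbers: queue lengths, numbers of arrivals, and schedules
(the latter have entries `0` and `1`). -/
abbrev NatMat (N : ℕ) : Type := Matrix (Fin N) (Fin N) ℕ

/-- `S` is a set of circuits of a crossbar: entries in `{0, 1}`, every source is connected to at most
one destination and every destination to at most one source. -/
structure IsSchedule {N : ℕ} (S : NatMat N) : Prop where
  le_one : ∀ i j, S i j ≤ 1
  row_sum_le : ∀ i, ∑ j, S i j ≤ 1
  col_sum_le : ∀ j, ∑ i, S i j ≤ 1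

/-- An optically switched network of `N` switches: the set of feasible schedules, the
reconfiguration delay `Δ_r` (in time slots), and the schedule `S(-1)` in place before slot `0`. -/
structure Network (N : ℕ) where
  feasible : Set (NatMat N)
  isSchedule : ∀ S ∈ feasible, IsSchedule S
  delay : ℝ
  initial : NatMat N
  initial_mem : initial ∈ feasible

/-- Every permutation matrix is a feasible schedule. -/
def Network.NonBlocking {N : ℕ} (net : Network N) : Prop :=
  ∀ σ : Equiv.Perm (Fin N), σ.permMatrix ℕ ∈ net.feasible

/-- The weight `⟨L, S⟩ = ∑ i, ∑ j, L i j * S i j` of the schedule `S` when the queue lengths are `L`. -/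
def weight {N : ℕ} (L S : NatMat N) : ℕ := ∑ i, ∑ j, L i j * S i j

/-- The total queue length `‖L‖ = ∑ i, ∑ j, L i j`. -/
def totalLength {N : ℕ} (L : NatMat N) : ℕ := ∑ i, ∑ j, L i j

/-- The state of the network at the beginning of slot `t`: the queue lengths `L(t)`, the previous
schedule `S(t-1)`, and the age `k` at slot `t - 1` of the current configuration, i.e. the latest
reconfiguration took place at slot `t - 1 - k` (`none` if there was none so far). -/
structure NetState (N : ℕ) where
  queue : NatMat N
  schedule : NatMat N
  age : Option ℕ

/-- The network starts empty. -/
def Network.init {N : ℕ} (net : Network N) : NetState N :=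
  ⟨0, net.initial, none⟩

open Classical in
/-- The age at slot `t` of the configuration, if schedule `S` is used in slot `t`: a reconfiguration
takes place at `t` exactly when `S(t) ≠ S(t-1)`. -/
noncomputable def NetState.newAge {N : ℕ} (x : NetState N) (S : NatMat N) : Option ℕ :=
  if S = x.schedule then x.age.map (· + 1) else some 0

open Classical in
/-- The departures `D(t)` when schedule `S` is used in slot `t`. Nothing departs in the slots
`t_k + τ`, `0 ≤ τ ≤ Δ_r`, after a reconfiguration at `t_k`; in every other slot one packet departs
from each nonempty queue that is connected. -/
noncomputable def Network.departures {N : ℕ} (net : Network N) (x : NetState N) (S : NatMat N) :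
    NatMat N := fun i j =>
  if (∃ k ∈ x.newAge S, (k : ℝ) ≤ net.delay) ∨ x.queue i j = 0 then 0 else S i j

/-- One slot, with schedule `S = S(t)` and arrivals `a = A(t)`: `L(t+1) = L(t) - D(t) + A(t)`.
(Always `D(t) ≤ L(t)` entrywise for feasible `S`, so the subtraction is not truncated.) -/
noncomputable def Network.step {N : ℕ} (net : Network N) (x : NetState N) (S a : NatMat N) :
    NetState N where
  queue := fun i j => x.queue i j - net.departures x S i j + a i j
  schedule := S
  age := x.newAge S

/-- The state at the beginning of slot `t` under the schedules `S(0), S(1), …` and the arrivals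
`a(0), a(1), …`. -/
noncomputable def Network.run {N : ℕ} (net : Network N) (S a : ℕ → NatMat N) : ℕ → NetState N
  | 0 => net.init
  | t + 1 => net.step (net.run S a t) (S t) (a t)

/-- A scheduling policy: it chooses a feasible schedule `S(t)` for each slot as a function of the
history up to `t`. As past schedules are themselves functions of past arrivals and everything is
countable, `S(t)` being measurable with respect to `σ(A(0), …, A(t), S(0), …, S(t-1))` means that
`S(t)` is a function of `A(0), …, A(t)`. -/
structure SchedulingPolicy {N : ℕ} (net : Network N) where
  schedule : (ℕ → NatMat N) → ℕ → NatMat N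
  feasible : ∀ a t, schedule a t ∈ net.feasible
  causal : ∀ a a' t, (∀ τ ≤ t, a τ = a' τ) → schedule a t = schedule a' t

/-- Arrival traffic: `A t ω i j` packets arrive at queue `(i, j)` in slot `t`. There is no queue
`(i, i)`. The arrivals are bounded, independent over the queues, and i.i.d. over time. -/
structure IsTraffic {N : ℕ} {Ω : Type*} [MeasurableSpace Ω] (μ : Measure Ω)
    (A : ℕ → Ω → NatMat N) : Prop where
  measurable : ∀ t i j, Measurable fun ω => A t ω i j
  diag : ∀ t ω i, A t ω i i = 0
  indep : iIndepFun (fun (p : ℕ × Fin N × Fin N) (ω : Ω) => A p.1 ω p.2.1 p.2.2) μ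
  identDistrib : ∀ t i j, IdentDistrib (fun ω => A t ω i j) (fun ω => A 0 ω i j) μ μ
  bounded : ∃ Amax : ℕ, ∀ t i j, ∀ᵐ ω ∂μ, A t ω i j ≤ Amax

/-- The queue lengths `L(t)` under the policy `π`. -/
noncomputable def SchedulingPolicy.queue {N : ℕ} {net : Network N} (π : SchedulingPolicy net)
    {Ω : Type*} (A : ℕ → Ω → NatMat N) (t : ℕ) (ω : Ω) : NatMat N :=
  (net.run (π.schedule fun τ => A τ ω) (fun τ => A τ ω) t).queue

/-- Strong stability: `limsup_{t → ∞} (1 / t) ∑_{τ < t} 𝔼 ‖L(τ)‖ < ∞`. -/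
def StronglyStable {N : ℕ} {net : Network N} (π : SchedulingPolicy net)
    {Ω : Type*} [MeasurableSpace Ω] (μ : Measure Ω) (A : ℕ → Ω → NatMat N) : Prop :=
  limsup (fun t : ℕ =>
    (∑ τ ∈ Finset.range t, ∫⁻ ω, (totalLength (π.queue A τ ω) : ℝ≥0∞) ∂μ) / (t : ℝ≥0∞)) atTop < ⊤

/-- The traffic is admissible if some scheduling policy strongly stabilizes the network. -/
def Admissible {N : ℕ} (net : Network N) {Ω : Type*} [MeasurableSpace Ω] (μ : Measure Ω)
    (A : ℕ → Ω → NatMat N) : Prop :=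
  ∃ π : SchedulingPolicy net, StronglyStable π μ A

/-- A policy is throughput optimal if it strongly stabilizes the network under any admissible
traffic. -/
def ThroughputOptimal {N : ℕ} {net : Network N} (π : SchedulingPolicy net) : Prop :=
  ∀ (Ω : Type u) [MeasurableSpace Ω] (μ : Measure Ω) [IsProbabilityMeasure μ]
    (A : ℕ → Ω → NatMat N), IsTraffic μ A → Admissible net μ A → StronglyStable π μ A

/-- Hysteresis functions. Only the values at nonnegative arguments matter. -/
structure IsHysteresis (g : ℝ → ℝ) : Prop where
  nonneg : ∀ x, 0 ≤ x → 0 ≤ g x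
  continuousOn : ContinuousOn g (Set.Ici 0)
  strictMonoOn : StrictMonoOn g (Set.Ici 0)
  sublinear : Tendsto (fun x => g x / x) atTop (𝓝 0)
  unbounded : Tendsto g atTop atTop

/-- A Hamiltonian walk on the complete graph whose vertices are the `N!` permutations: it visits
each of them exactly once during the slots `0, …, N! - 1`, and is continued periodically. -/
structure IsHamiltonianWalk {N : ℕ} (H : ℕ → Equiv.Perm (Fin N)) : Prop where
  visits : ∀ σ, ∃! t, t < N ! ∧ H t = σ
  periodic : ∀ t, H (t + N !) = H t

/-- The Hamiltonian policy: `Π_H(t)` from the queue lengths `L = L(t)`, `last = Π_H(t-1)` and the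
schedule `h = H(t)` on the walk. -/
def hamiltonianChoice {N : ℕ} (L last h : NatMat N) : NatMat N :=
  if weight L h ≤ weight L last then last else h

open Classical in
/-- The `g`-adaptive rule: from `L = L(t)`, `prev = S(t-1)` and the proposed schedule `P = Π(t)`,
keep `S(t-1)` if `W_Π(t) - W_{S(t-1)}(t) ≤ g (W_Π(t))`, and otherwise use `Π(t)`. -/
noncomputable def adaptiveChoice {N : ℕ} (g : ℝ → ℝ) (L prev P : NatMat N) : NatMat N :=
  if (weight L P : ℝ) - (weight L prev : ℝ) ≤ g (weight L P) then prev else P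

namespace AdaptiveHamiltonian

variable {N : ℕ} (net : Network N) (g : ℝ → ℝ) (H : ℕ → Equiv.Perm (Fin N)) (P₀ : NatMat N)

/-- `Π_H(t)`, when the state at the beginning of slot `t` is `x` and `last = Π_H(t-1)`. -/
def proposal (t : ℕ) (x : NetState N) (last : NatMat N) : NatMat N :=
  hamiltonianChoice x.queue last ((H t).permMatrix ℕ)

/-- `S(t)`, when the state at the beginning of slot `t` is `x` and `last = Π_H(t-1)`. -/
noncomputable def choice (t : ℕ) (x : NetState N) (last : NatMat N) : NatMat N :=
  adaptiveChoice g x.queue x.schedule (proposal H t x last)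

/-- The state at the beginning of slot `t`, together with `Π_H(t-1)`, in the network that is
scheduled by the `g`-adaptive variant of the Hamiltonian policy with `Π_H(-1) = P₀`. -/
noncomputable def closedLoop (a : ℕ → NatMat N) : ℕ → NetState N × NatMat N
  | 0 => (net.init, P₀)
  | t + 1 =>
    (net.step (closedLoop a t).1 (choice g H t (closedLoop a t).1 (closedLoop a t).2) (a t),
      proposal H t (closedLoop a t).1 (closedLoop a t).2)

/-- The schedule `S(t)`. -/
noncomputable def schedule (a : ℕ → NatMat N) (t : ℕ) : NatMat N :=
  choice g H t (closedLoop net g H P₀ a t).1 (closedLoop net g H P₀ a t).2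

theorem closedLoop_fst (a : ℕ → NatMat N) (t : ℕ) :
    (closedLoop net g H P₀ a t).1 = net.run (schedule net g H P₀ a) a t := by
  induction t with
  | zero => rfl
  | succ t ih =>
    rw [Network.run, ← ih]
    rfl

theorem closedLoop_congr {a a' : ℕ → NatMat N} {t : ℕ} (h : ∀ τ < t, a τ = a' τ) :
    closedLoop net g H P₀ a t = closedLoop net g H P₀ a' t := by
  induction t with
  | zero => rfl
  | succ t ih =>
    simp only [closedLoop, ih fun τ hτ => h τ (by omega), h t (by omega)]

variable {net P₀}

theorem closedLoop_mem (hnet : net.NonBlocking) (hP : P₀ ∈ net.feasible) (a : ℕ → NatMat N)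
    (t : ℕ) : (closedLoop net g H P₀ a t).1.schedule ∈ net.feasible ∧
      (closedLoop net g H P₀ a t).2 ∈ net.feasible := by
  induction t with
  | zero => exact ⟨net.initial_mem, hP⟩
  | succ t ih =>
    have h2 : proposal H t (closedLoop net g H P₀ a t).1 (closedLoop net g H P₀ a t).2
        ∈ net.feasible := by
      unfold proposal hamiltonianChoice
      split_ifs
      exacts [ih.2, hnet _]
    refine ⟨?_, h2⟩
    change adaptiveChoice g _ _ _ ∈ net.feasible
    unfold adaptiveChoice
    split_ifs
    exacts [ih.1, h2]

/-- The `g`-adaptive variant of the Hamiltonian policy with walk `H` and initial memory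
`Π_H(-1) = P₀`. -/
noncomputable def policy (hnet : net.NonBlocking) (hP : P₀ ∈ net.feasible) :
    SchedulingPolicy net where
  schedule := schedule net g H P₀
  feasible := fun a t => (closedLoop_mem g H hnet hP a (t + 1)).1
  causal := fun a a' t h => by
    simp only [schedule, closedLoop_congr net g H P₀ fun τ hτ => h τ (le_of_lt hτ)]

end AdaptiveHamiltonian

/-! A row or a column of queues sends at most one packet per slot. A stabilizing policy therefore
forces the arrival rates of each line to add up to less than one, or to exactly one with
deterministic arrivals in that line (`IsTraffic.sum_rate_lt_one_or`). If the sum exceeds one, the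
mean queue grows linearly. If it equals one with positive variance, the queue dominates the positive
part of a centred random walk, whose mean is unbounded.

If all line sums are below one, a Foster-Lyapunov argument applies (`exists_lyapunov_drift`). The
walk revisits every permutation within `N !` slots, so proposals are maximal up to a constant, and
sublinearity of `g` makes the schedule in use maximal up to a small fraction. Unboundedness of `g`
makes reconfigurations rare when queues are long. The slots lost to them are paid for by a second
term in the Lyapunov function, the maximal weight times a potential of the age, which recovers
slowly between reconfigurations.

If some line sum equals one, integrality gives a queue that receives exactly one packet in every
slot. This queue never makes up for a reconfiguration, so a stabilizing policy has a bounded mean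
number of them and cannot alternate between two conflicting queues
(`IsTraffic.rate_eq_zero_of_conflict`). Hence all queues with traffic lie on one permutation `σ`.
Schedules covering them have the largest possible weight. The walk finds such a proposal after a
time with geometric tail and keeps it. A schedule missing a queue is then dropped, because that
queue grows linearly while the threshold is sublinear. Once both proposal and schedule cover, no
reconfiguration occurs, so the mean total loss of service is finite
(`IsTraffic.exists_sum_missing_le`) and each queue is a permanently served one plus a bounded mean
(`stronglyStable_of_isSupported`). -/

/-! ### Functions of the arrivals before a given slot -/

section Traffic

variable {N : ℕ} {Ω : Type*} [MeasurableSpace Ω] {μ : Measure Ω} {A : ℕ → Ω → NatMat N}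

/-- A function of the past uses finitely many natural numbers. On such a discrete domain
measurability is automatic, and independence can be applied to finite families. -/
theorem DependsOn.exists_factor_Iio {β : Type*} {F : (ℕ → NatMat N) → β} {t : ℕ}
    (hF : DependsOn F (Set.Iio t)) :
    ∃ f : (((Finset.range t ×ˢ Finset.univ : Finset (ℕ × Fin N × Fin N))) → ℕ) → β,
      ∀ a, F a = f fun p => a p.1.1 p.1.2.1 p.1.2.2 := by
  -- The missing arrivals, from slot `t` on, are filled with zeros; `F` does not see them.
  refine ⟨fun x => F fun τ i j => if h : τ < t then x ⟨(τ, i, j), by simp [h]⟩ else 0,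
    fun a => hF fun τ hτ => ?_⟩
  ext i j
  have : τ < t := hτ
  simp [this]

theorem dependsOn_eval (t : ℕ) {β : Type*} (G : NatMat N → β) :
    DependsOn (fun a : ℕ → NatMat N => G (a t)) (Set.Iio (t + 1)) :=
  fun _ _ h => by
    simp only [h t (Set.mem_Iio.2 (Nat.lt_succ_self t))]

theorem DependsOn.of_le {β : Type*} {F : (ℕ → NatMat N) → β} {s t : ℕ}
    (hF : DependsOn F (Set.Iio s)) (h : s ≤ t) : DependsOn F (Set.Iio t) :=
  fun _ _ hx => hF fun τ hτ => hx τ (lt_of_lt_of_le hτ h)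

namespace IsTraffic

theorem ae_bounded (hA : IsTraffic μ A) : ∃ K : ℕ, ∀ᵐ ω ∂μ, ∀ t i j, A t ω i j ≤ K := by
  obtain ⟨K, hK⟩ := hA.bounded
  exact ⟨K, ae_all_iff.2 fun t => ae_all_iff.2 fun i => ae_all_iff.2 fun j => hK t i j⟩

theorem measurable_of_dependsOn (hA : IsTraffic μ A) {β : Type*} [MeasurableSpace β]
    {F : (ℕ → NatMat N) → β} {t : ℕ} (hF : DependsOn F (Set.Iio t)) :
    Measurable fun ω => F fun τ => A τ ω := by
  obtain ⟨f, hf⟩ := hF.exists_factor_Iio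
  simp only [hf]
  exact (Measurable.of_discrete (f := f)).comp
    (measurable_pi_lambda _ fun p => hA.measurable _ _ _)

/-- Almost surely the relevant arrivals lie in a finite box, where any function is bounded. -/
theorem integrable_of_dependsOn [IsProbabilityMeasure μ] (hA : IsTraffic μ A)
    {F : (ℕ → NatMat N) → ℝ} {t : ℕ} (hF : DependsOn F (Set.Iio t)) :
    Integrable (fun ω => F fun τ => A τ ω) μ := by
  obtain ⟨K, hK⟩ := hA.ae_bounded
  have hm := hA.measurable_of_dependsOn hF
  obtain ⟨f, hf⟩ := hF.exists_factor_Iio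
  have hfin : (Set.Iic (fun _ : ((Finset.range t ×ˢ Finset.univ :
      Finset (ℕ × Fin N × Fin N))) => K)).Finite := Set.finite_Iic _
  obtain ⟨C, hC⟩ := (hfin.image fun x => ‖f x‖).bddAbove
  refine Integrable.of_bound hm.aestronglyMeasurable C ?_
  filter_upwards [hK] with ω hω
  rw [hf]
  exact hC ⟨_, fun p => hω _ _ _, rfl⟩

theorem integrable_eval [IsProbabilityMeasure μ] (hA : IsTraffic μ A) (t : ℕ)
    (G : NatMat N → ℝ) : Integrable (fun ω => G (A t ω)) μ :=
  hA.integrable_of_dependsOn (F := fun a => G (a t)) (dependsOn_eval t G)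

/-- The slots before `t` and slot `t` give disjoint families of independent variables. Typically `F`
is a queue length at the beginning of slot `t`, which does not involve the arrivals of that slot. -/
theorem integral_mul [IsProbabilityMeasure μ] (hA : IsTraffic μ A)
    {F : (ℕ → NatMat N) → ℝ} {t : ℕ} (hF : DependsOn F (Set.Iio t)) (G : NatMat N → ℝ) :
    ∫ ω, F (fun τ => A τ ω) * G (A t ω) ∂μ
      = (∫ ω, F (fun τ => A τ ω) ∂μ) * ∫ ω, G (A t ω) ∂μ := by
  have hind := hA.indep.indepFun_finset (Finset.range t ×ˢ Finset.univ)
    ({t} ×ˢ Finset.univ) (by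
      rw [Finset.disjoint_left]
      rintro ⟨s, p⟩ h1 h2
      simp only [Finset.mem_product, Finset.mem_range, Finset.mem_singleton] at h1 h2
      omega) (fun p => hA.measurable _ _ _)
  obtain ⟨f, hf⟩ := hF.exists_factor_Iio
  let g : (({t} ×ˢ Finset.univ : Finset (ℕ × Fin N × Fin N)) → ℕ) → ℝ :=
    fun x => G fun i j => x ⟨(t, i, j), by simp⟩
  have hg : ∀ ω, G (A t ω) = g fun p => A p.1.1 ω p.1.2.1 p.1.2.2 := fun ω => rfl
  simp only [hf, hg]
  have := hind.comp (Measurable.of_discrete (f := f)) (Measurable.of_discrete (f := g))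
  refine this.integral_fun_mul_eq_mul_integral ?_ ?_
  · exact ((Measurable.of_discrete (f := f)).comp
      (measurable_pi_lambda _ fun p => hA.measurable _ _ _)).aestronglyMeasurable
  · exact ((Measurable.of_discrete (f := g)).comp
      (measurable_pi_lambda _ fun p => hA.measurable _ _ _)).aestronglyMeasurable

theorem integral_entry [IsProbabilityMeasure μ] (hA : IsTraffic μ A) (t : ℕ) (i j : Fin N)
    (G : ℕ → ℝ) : ∫ ω, G (A t ω i j) ∂μ = ∫ ω, G (A 0 ω i j) ∂μ :=
  ((hA.identDistrib t i j).comp (u := G) Measurable.of_discrete).integral_eq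

theorem indepFun_entry (hA : IsTraffic μ A) (t : ℕ) {p q : Fin N × Fin N} (h : p ≠ q) :
    IndepFun (fun ω => A t ω p.1 p.2) (fun ω => A t ω q.1 q.2) μ :=
  hA.indep.indepFun (i := (t, p)) (j := (t, q)) (by simpa using h)

theorem ae_entry (hA : IsTraffic μ A) {i j : Fin N} {P : ℕ → Prop}
    (h : ∀ᵐ ω ∂μ, P (A 0 ω i j)) : ∀ᵐ ω ∂μ, ∀ t, P (A t ω i j) :=
  ae_all_iff.2 fun t => (hA.identDistrib t i j).symm.ae_snd (p := P) (Set.to_countable _).measurableSet h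

end IsTraffic

/-- The arrival rate `𝔼 A i j` of the queue `(i, j)`. -/
noncomputable def arrivalRate (μ : Measure Ω) (A : ℕ → Ω → NatMat N) (i j : Fin N) : ℝ :=
  ∫ ω, (A 0 ω i j : ℝ) ∂μ

theorem arrivalRate_nonneg (i j : Fin N) : 0 ≤ arrivalRate μ A i j :=
  integral_nonneg fun _ => Nat.cast_nonneg _

theorem IsTraffic.integral_arrival [IsProbabilityMeasure μ] (hA : IsTraffic μ A) (t : ℕ)
    (i j : Fin N) : ∫ ω, (A t ω i j : ℝ) ∂μ = arrivalRate μ A i j :=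
  hA.integral_entry t i j fun n => n

theorem IsTraffic.ae_eq_zero_of_arrivalRate_eq_zero [IsProbabilityMeasure μ]
    (hA : IsTraffic μ A) {i j : Fin N} (h : arrivalRate μ A i j = 0) :
    ∀ᵐ ω ∂μ, ∀ t, A t ω i j = 0 := by
  refine hA.ae_entry (P := fun n => n = 0) ?_
  have := (integral_eq_zero_iff_of_nonneg (fun ω => Nat.cast_nonneg (A 0 ω i j))
    (hA.integrable_eval 0 fun M => (M i j : ℝ))).1 h
  filter_upwards [this] with ω hω
  simpa using hω

end Traffic

/-! ### Weights of schedules -/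

section Weight

variable {N : ℕ}

/-- The largest weight of a permutation matrix. -/
def maxWeight (L : NatMat N) : ℕ :=
  Finset.univ.sup fun σ : Equiv.Perm (Fin N) => weight L (σ.permMatrix ℕ)

theorem permMatrix_entry {R : Type*} [Zero R] [One R] (σ : Equiv.Perm (Fin N)) (i j : Fin N) :
    σ.permMatrix R i j = if σ i = j then 1 else 0 := by
  simp [Equiv.Perm.permMatrix, PEquiv.toMatrix_apply, Equiv.toPEquiv_apply]

theorem weight_permMatrix (L : NatMat N) (σ : Equiv.Perm (Fin N)) :
    weight L (σ.permMatrix ℕ) = ∑ i, L i (σ i) := by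
  simp [weight]

theorem weight_permMatrix_le (L : NatMat N) (σ : Equiv.Perm (Fin N)) :
    weight L (σ.permMatrix ℕ) ≤ maxWeight L :=
  Finset.le_sup (f := fun σ : Equiv.Perm (Fin N) => weight L (σ.permMatrix ℕ))
    (Finset.mem_univ σ)

theorem exists_weight_eq_maxWeight (L : NatMat N) :
    ∃ σ : Equiv.Perm (Fin N), weight L (σ.permMatrix ℕ) = maxWeight L := by
  obtain ⟨σ, -, h⟩ := Finset.exists_mem_eq_sup Finset.univ Finset.univ_nonempty
    fun σ : Equiv.Perm (Fin N) => weight L (σ.permMatrix ℕ)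
  exact ⟨σ, h.symm⟩

theorem isSchedule_permMatrix (σ : Equiv.Perm (Fin N)) : IsSchedule (σ.permMatrix ℕ) where
  le_one i j := by rw [permMatrix_entry]; split_ifs <;> simp
  row_sum_le i := by simp
  col_sum_le j := by
    simp only [permMatrix_entry, ← Equiv.eq_symm_apply]
    simp

/-- A doubly substochastic matrix is dominated by a doubly stochastic one. -/
theorem exists_doublyStochastic_ge (M : Matrix (Fin N) (Fin N) ℝ) (h0 : ∀ i j, 0 ≤ M i j)
    (hr : ∀ i, ∑ j, M i j ≤ 1) (hc : ∀ j, ∑ i, M i j ≤ 1) :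
    ∃ M' ∈ doublyStochastic ℝ (Fin N), ∀ i j, M i j ≤ M' i j := by
  set u : Fin N → ℝ := fun i => 1 - ∑ j, M i j with hu
  set v : Fin N → ℝ := fun j => 1 - ∑ i, M i j with hv
  have hu0 : ∀ i, 0 ≤ u i := fun i => sub_nonneg.2 (hr i)
  have hv0 : ∀ j, 0 ≤ v j := fun j => sub_nonneg.2 (hc j)
  have huv : ∑ i, u i = ∑ j, v j := by
    simp only [hu, hv, Finset.sum_sub_distrib]
    rw [Finset.sum_comm]
  -- The deficits have equal totals. If the total vanishes, so does every deficit, and division by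
  -- zero does no harm.
  have key : ∀ i, u i * ((∑ j, v j) / ∑ i, u i) = u i := by
    intro i
    rcases eq_or_ne (∑ i, u i) 0 with h | h
    · rw [(Finset.sum_eq_zero_iff_of_nonneg fun i _ => hu0 i).1 h i (Finset.mem_univ i), zero_mul]
    · rw [← huv, div_self h, mul_one]
  have key' : ∀ j, v j * ((∑ i, u i) / ∑ i, u i) = v j := by
    intro j
    rcases eq_or_ne (∑ i, u i) 0 with h | h
    · rw [(Finset.sum_eq_zero_iff_of_nonneg fun i _ => hv0 i).1 (huv ▸ h) j (Finset.mem_univ j),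
        zero_mul]
    · rw [div_self h, mul_one]
  refine ⟨Matrix.of fun i j => M i j + u i * v j / ∑ i, u i, ?_, fun i j => ?_⟩
  · rw [mem_doublyStochastic_iff_sum]
    refine ⟨fun i j => add_nonneg (h0 i j) (div_nonneg (mul_nonneg (hu0 i) (hv0 j))
      (Finset.sum_nonneg fun i _ => hu0 i)), fun i => ?_, fun j => ?_⟩
    · simp only [Matrix.of_apply]
      rw [Finset.sum_add_distrib, ← Finset.sum_div, ← Finset.mul_sum, mul_div_assoc, key]
      simp [hu]
    · simp only [Matrix.of_apply]
      rw [Finset.sum_add_distrib, ← Finset.sum_div, ← Finset.sum_mul, mul_comm, mul_div_assoc,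
        key']
      simp [hv]
  · exact le_add_of_nonneg_right (div_nonneg (mul_nonneg (hu0 i) (hv0 j))
      (Finset.sum_nonneg fun i _ => hu0 i))

/-- Birkhoff's theorem, as a bound of the weight of a doubly substochastic matrix. -/
theorem sum_mul_le_maxWeight (L : NatMat N) (M : Matrix (Fin N) (Fin N) ℝ)
    (h0 : ∀ i j, 0 ≤ M i j) (hr : ∀ i, ∑ j, M i j ≤ 1) (hc : ∀ j, ∑ i, M i j ≤ 1) :
    ∑ i, ∑ j, (L i j : ℝ) * M i j ≤ maxWeight L := by
  obtain ⟨M', hM', hle⟩ := exists_doublyStochastic_ge M h0 hr hc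
  obtain ⟨w, hw0, hw1, rfl⟩ := exists_eq_sum_perm_of_mem_doublyStochastic hM'
  calc ∑ i, ∑ j, (L i j : ℝ) * M i j
      ≤ ∑ i, ∑ j, (L i j : ℝ) * (∑ σ, w σ • σ.permMatrix ℝ : Matrix (Fin N) (Fin N) ℝ) i j := by
        gcongr with i _ j _
        exact hle i j
    _ = ∑ σ, w σ * (weight L (σ.permMatrix ℕ) : ℝ) := by
        simp only [weight_permMatrix, Matrix.sum_apply, Matrix.smul_apply, smul_eq_mul,
          permMatrix_entry, Finset.mul_sum, Nat.cast_sum]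
        rw [Finset.sum_congr rfl fun i _ => Finset.sum_comm, Finset.sum_comm]
        refine Finset.sum_congr rfl fun σ _ => Finset.sum_congr rfl fun i _ => ?_
        simp [mul_comm]
    _ ≤ ∑ σ, w σ * (maxWeight L : ℝ) := by
        gcongr with σ _
        · exact hw0 σ
        · exact weight_permMatrix_le L σ
    _ = maxWeight L := by rw [← Finset.sum_mul, hw1, one_mul]

theorem IsSchedule.weight_le_maxWeight {S : NatMat N} (hS : IsSchedule S) (L : NatMat N) :
    weight L S ≤ maxWeight L := by
  have := sum_mul_le_maxWeight L (fun i j => (S i j : ℝ)) (fun i j => Nat.cast_nonneg _)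
    (fun i => by exact_mod_cast hS.row_sum_le i) (fun j => by exact_mod_cast hS.col_sum_le j)
  simp only [weight]
  exact_mod_cast this

/-- The weight of the rates is at most a fraction of the largest weight if the rates lie in the
interior of the capacity region. -/
theorem sum_mul_le_mul_maxWeight (L : NatMat N) (M : Matrix (Fin N) (Fin N) ℝ) {r : ℝ}
    (hr0 : 0 < r) (h0 : ∀ i j, 0 ≤ M i j) (hr : ∀ i, ∑ j, M i j ≤ r)
    (hc : ∀ j, ∑ i, M i j ≤ r) :
    ∑ i, ∑ j, (L i j : ℝ) * M i j ≤ r * maxWeight L := by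
  have := sum_mul_le_maxWeight L (fun i j => M i j / r) (fun i j => div_nonneg (h0 i j) hr0.le)
    (fun i => by rw [← Finset.sum_div]; exact (div_le_one hr0).2 (hr i))
    (fun j => by rw [← Finset.sum_div]; exact (div_le_one hr0).2 (hc j))
  simp only [← mul_div_assoc, ← Finset.sum_div] at this
  rwa [div_le_iff₀' hr0] at this

/-- A set of positions without two in a line is contained in a permutation matrix. -/
theorem exists_perm_of_isSchedule {S : NatMat N} (hS : IsSchedule S) :
    ∃ σ : Equiv.Perm (Fin N), ∀ i j, S i j ≠ 0 → σ i = j := by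
  -- Take `S` itself as the queue lengths. By Birkhoff some permutation weighs at least as much as
  -- `S` against itself, which is the number of its ones, so it contains them all.
  obtain ⟨σ, hσ⟩ := exists_weight_eq_maxWeight S
  have h1 := hS.weight_le_maxWeight S
  rw [← hσ, weight, weight] at h1
  have hle : ∀ i j, S i j * σ.permMatrix ℕ i j ≤ S i j * S i j := by
    intro i j
    have h := hS.le_one i j
    interval_cases h' : S i j
    · simp
    · simpa using (isSchedule_permMatrix σ).le_one i j
  refine ⟨σ, fun i j hij => ?_⟩
  have h2 : ∑ i, ∑ j, S i j * σ.permMatrix ℕ i j = ∑ i, ∑ j, S i j * S i j :=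
    le_antisymm (Finset.sum_le_sum fun i _ => Finset.sum_le_sum fun j _ => hle i j) h1
  have h3 := (Finset.sum_eq_sum_iff_of_le fun i _ =>
    Finset.sum_le_sum fun j _ => hle i j).1 h2 i (Finset.mem_univ i)
  have h4 := (Finset.sum_eq_sum_iff_of_le fun j _ => hle i j).1 h3 j (Finset.mem_univ j)
  by_contra hne
  rw [permMatrix_entry, if_neg hne, mul_zero] at h4
  exact hij (by simpa using h4.symm)

theorem apply_le_maxWeight (L : NatMat N) (i j : Fin N) : L i j ≤ maxWeight L := by
  refine le_trans ?_ (weight_permMatrix_le L (Equiv.swap i j))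
  rw [weight_permMatrix]
  refine le_trans ?_ (Finset.single_le_sum (f := fun k => L k (Equiv.swap i j k))
    (fun _ _ => Nat.zero_le _) (Finset.mem_univ i))
  simp

theorem totalLength_le_mul_maxWeight (L : NatMat N) : totalLength L ≤ N * N * maxWeight L := by
  calc totalLength L ≤ ∑ _i : Fin N, ∑ _j : Fin N, maxWeight L :=
        Finset.sum_le_sum fun i _ => Finset.sum_le_sum fun j _ => apply_le_maxWeight L i j
    _ = N * N * maxWeight L := by simp [mul_assoc]

end Weight

/-! ### Sample paths of the network -/

section Dynamics

variable {N : ℕ} {net : Network N} {S a : ℕ → NatMat N} {K : ℕ}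

/-- No packet departs in the slot because of a recent reconfiguration. -/
def Network.Blocked (net : Network N) (x : NetState N) (S : NatMat N) : Prop :=
  ∃ k ∈ x.newAge S, (k : ℝ) ≤ net.delay

theorem Network.departures_le_schedule (x : NetState N) (S : NatMat N) (i j : Fin N) :
    net.departures x S i j ≤ S i j := by
  unfold Network.departures
  split_ifs <;> simp

theorem Network.departures_eq_zero_of_blocked {x : NetState N} {S : NatMat N}
    (h : net.Blocked x S) (i j : Fin N) : net.departures x S i j = 0 :=
  if_pos (Or.inl h)

theorem Network.departures_le_queue {x : NetState N} {S : NatMat N} (hS : IsSchedule S)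
    (i j : Fin N) : net.departures x S i j ≤ x.queue i j := by
  unfold Network.departures
  split_ifs with h
  · simp
  · exact (hS.le_one i j).trans (Nat.one_le_iff_ne_zero.2 fun h0 => h (Or.inr h0))

theorem Network.queue_mul_departures {x : NetState N} {S : NatMat N} (h : ¬ net.Blocked x S)
    (i j : Fin N) : x.queue i j * net.departures x S i j = x.queue i j * S i j := by
  unfold Network.departures
  by_cases h0 : x.queue i j = 0
  · simp [h0]
  · have hn : ¬ ((∃ k ∈ x.newAge S, (k : ℝ) ≤ net.delay) ∨ x.queue i j = 0) :=
      not_or.2 ⟨h, h0⟩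
    rw [if_neg hn]

theorem Network.run_queue_succ (t : ℕ) (i j : Fin N) :
    (net.run S a (t + 1)).queue i j = (net.run S a t).queue i j
      - net.departures (net.run S a t) (S t) i j + a t i j := rfl

theorem Network.run_queue_zero (i j : Fin N) : (net.run S a 0).queue i j = 0 := rfl

theorem Network.run_queue_succ_add (hS : ∀ t, S t ∈ net.feasible) (t : ℕ) (i j : Fin N) :
    (net.run S a (t + 1)).queue i j + net.departures (net.run S a t) (S t) i j
      = (net.run S a t).queue i j + a t i j := by
  have := Network.departures_le_queue (net := net) (x := net.run S a t)
    (net.isSchedule _ (hS t)) i j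
  rw [Network.run_queue_succ]
  omega

theorem Network.run_queue_succ_le (ha : ∀ t i j, a t i j ≤ K) (t : ℕ) (i j : Fin N) :
    (net.run S a (t + 1)).queue i j ≤ (net.run S a t).queue i j + K := by
  have := ha t i j
  rw [Network.run_queue_succ]
  omega

theorem Network.run_queue_le_succ (hS : ∀ t, S t ∈ net.feasible) (t : ℕ) (i j : Fin N) :
    (net.run S a t).queue i j ≤ (net.run S a (t + 1)).queue i j + 1 := by
  have := (Network.departures_le_schedule (net := net) (net.run S a t) (S t) i j).trans
    ((net.isSchedule _ (hS t)).le_one i j)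
  rw [Network.run_queue_succ]
  omega

/-- Only the arrivals before slot `t` matter for the state at the beginning of slot `t`. -/
theorem Network.run_congr {S' a' : ℕ → NatMat N} {t : ℕ} (hS : ∀ τ < t, S τ = S' τ)
    (ha : ∀ τ < t, a τ = a' τ) : net.run S a t = net.run S' a' t := by
  induction t with
  | zero => rfl
  | succ t ih =>
    simp only [Network.run, hS t (Nat.lt_succ_self t), ha t (Nat.lt_succ_self t),
      ih (fun τ hτ => hS τ (by omega)) fun τ hτ => ha τ (by omega)]

theorem weight_le_weight_add {L L' R : NatMat N} {C : ℕ} (hR : ∀ i j, R i j ≤ 1)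
    (h : ∀ i j, L i j ≤ L' i j + C) : weight L R ≤ weight L' R + N * N * C := by
  have : (N * N * C) = ∑ _i : Fin N, ∑ _j : Fin N, C := by simp [mul_assoc]
  rw [this, weight, weight, ← Finset.sum_add_distrib]
  refine Finset.sum_le_sum fun i _ => ?_
  rw [← Finset.sum_add_distrib]
  refine Finset.sum_le_sum fun j _ => ?_
  calc L i j * R i j ≤ (L' i j + C) * R i j := Nat.mul_le_mul_right _ (h i j)
    _ = L' i j * R i j + C * R i j := add_mul _ _ _
    _ ≤ L' i j * R i j + C := by
      have := Nat.mul_le_mul_left C (hR i j)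
      omega

theorem weight_le_totalLength {L R : NatMat N} (hR : ∀ i j, R i j ≤ 1) :
    weight L R ≤ totalLength L :=
  Finset.sum_le_sum fun i _ => Finset.sum_le_sum fun j _ => by
    simpa using Nat.mul_le_mul_left (L i j) (hR i j)

/-- A queue gains at most `K` and loses at most one packet per slot. The same unit `N * N * (K + 1)`
serves for both directions. -/
theorem weight_run_add_le (ha : ∀ t i j, a t i j ≤ K) {R : NatMat N} (hR : ∀ i j, R i j ≤ 1)
    (t k : ℕ) : weight (net.run S a (t + k)).queue R
      ≤ weight (net.run S a t).queue R + k * (N * N * (K + 1)) := by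
  induction k with
  | zero => simp
  | succ k ih =>
    have := weight_le_weight_add hR (Network.run_queue_succ_le (net := net) (S := S) ha (t + k))
    have h2 : N * N * K ≤ N * N * (K + 1) := Nat.mul_le_mul_left _ (Nat.le_succ K)
    rw [← add_assoc, Nat.succ_mul]
    omega

theorem weight_run_le_add (hS : ∀ t, S t ∈ net.feasible) (K : ℕ) {R : NatMat N}
    (hR : ∀ i j, R i j ≤ 1) (t k : ℕ) : weight (net.run S a t).queue R
      ≤ weight (net.run S a (t + k)).queue R + k * (N * N * (K + 1)) := by
  induction k with
  | zero => simp
  | succ k ih =>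
    have := weight_le_weight_add hR (Network.run_queue_le_succ (a := a) hS (t + k))
    have h2 : N * N * 1 ≤ N * N * (K + 1) := Nat.mul_le_mul_left _ (by omega)
    rw [← add_assoc, Nat.succ_mul]
    omega

theorem maxWeight_run_succ_le (ha : ∀ t i j, a t i j ≤ K) (t : ℕ) :
    maxWeight (net.run S a (t + 1)).queue
      ≤ maxWeight (net.run S a t).queue + N * N * (K + 1) := by
  obtain ⟨σ, hσ⟩ := exists_weight_eq_maxWeight (net.run S a (t + 1)).queue
  have h1 := weight_run_add_le (net := net) (S := S) ha (isSchedule_permMatrix σ).le_one t 1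
  have h2 := weight_permMatrix_le (net.run S a t).queue σ
  omega

theorem totalLength_run_le (ha : ∀ t i j, a t i j ≤ K) (t : ℕ) :
    totalLength (net.run S a t).queue ≤ N * N * K * t := by
  have h : ∀ i j, (net.run S a t).queue i j ≤ K * t := by
    intro i j
    induction t with
    | zero => simp [Network.run_queue_zero]
    | succ t ih =>
      have := Network.run_queue_succ_le (net := net) (S := S) ha t i j
      rw [Nat.mul_succ]
      omega
  calc totalLength (net.run S a t).queue ≤ ∑ _i : Fin N, ∑ _j : Fin N, K * t :=
        Finset.sum_le_sum fun i _ => Finset.sum_le_sum fun j _ => h i j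
    _ = N * N * K * t := by simp [mul_assoc]

end Dynamics

/-! ### Sample paths of the adaptive Hamiltonian policy -/

section Adaptive

variable {N : ℕ} {net : Network N} {g : ℝ → ℝ} {H : ℕ → Equiv.Perm (Fin N)}
  {S a P : ℕ → NatMat N} {K : ℕ}

/-- With the arrivals `a`, the schedules `S` and the proposals `P` follow the `g`-adaptive
variant of the Hamiltonian policy. -/
structure IsAdaptive (net : Network N) (g : ℝ → ℝ) (H : ℕ → Equiv.Perm (Fin N))
    (a S P : ℕ → NatMat N) : Prop where
  feasible : ∀ t, S t ∈ net.feasible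
  isSchedule : ∀ t, IsSchedule (P t)
  proposal_ge : ∀ t, weight (net.run S a t).queue ((H t).permMatrix ℕ)
    ≤ weight (net.run S a t).queue (P t)
  proposal_succ : ∀ t, P (t + 1) = hamiltonianChoice (net.run S a (t + 1)).queue (P t)
    ((H (t + 1)).permMatrix ℕ)
  choice : ∀ t, S t = adaptiveChoice g (net.run S a t).queue (net.run S a t).schedule (P t)

theorem weight_le_hamiltonianChoice (L last h : NatMat N) :
    weight L h ≤ weight L (hamiltonianChoice L last h)
      ∧ weight L last ≤ weight L (hamiltonianChoice L last h) := by
  unfold hamiltonianChoice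
  split_ifs with hc
  · exact ⟨hc, le_rfl⟩
  · exact ⟨le_rfl, (not_le.1 hc).le⟩

theorem AdaptiveHamiltonian.isAdaptive {P₀ : NatMat N} (g : ℝ → ℝ)
    (H : ℕ → Equiv.Perm (Fin N)) (hnet : net.NonBlocking) (hP : P₀ ∈ net.feasible)
    (a : ℕ → NatMat N) :
    IsAdaptive net g H a (AdaptiveHamiltonian.schedule net g H P₀ a)
      (fun t => (AdaptiveHamiltonian.closedLoop net g H P₀ a (t + 1)).2) where
  feasible t := (AdaptiveHamiltonian.closedLoop_mem g H hnet hP a (t + 1)).1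
  isSchedule t := net.isSchedule _ (AdaptiveHamiltonian.closedLoop_mem g H hnet hP a (t + 1)).2
  proposal_ge t := by
    rw [← AdaptiveHamiltonian.closedLoop_fst]
    exact (weight_le_hamiltonianChoice _ _ _).1
  proposal_succ t := by
    rw [← AdaptiveHamiltonian.closedLoop_fst]
    rfl
  choice t := by
    rw [← AdaptiveHamiltonian.closedLoop_fst]
    rfl

namespace IsAdaptive

/-- A proposal is only replaced by one that is heavier at the current queues, so its weight falls no
faster than departures allow. -/
theorem weight_proposal_le (h : IsAdaptive net g H a S P) (K t k : ℕ) :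
    weight (net.run S a t).queue (P t)
      ≤ weight (net.run S a (t + k)).queue (P (t + k)) + k * (N * N * (K + 1)) := by
  induction k with
  | zero => simp
  | succ k ih =>
    have h1 := weight_run_le_add (a := a) h.feasible K (h.isSchedule (t + k)).le_one (t + k) 1
    have h2 := (weight_le_hamiltonianChoice (net.run S a (t + k + 1)).queue (P (t + k))
      ((H (t + k + 1)).permMatrix ℕ)).2
    rw [← h.proposal_succ] at h2
    rw [← add_assoc, Nat.succ_mul]
    omega

end IsAdaptive

theorem IsHamiltonianWalk.apply_add_mul (hH : IsHamiltonianWalk H) (t k : ℕ) :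
    H (t + N ! * k) = H t := by
  induction k with
  | zero => simp
  | succ k ih => rw [Nat.mul_succ, ← add_assoc, hH.periodic, ih]

namespace IsAdaptive

/-- The proposals have almost maximal weight. -/
theorem maxWeight_le_proposal (h : IsAdaptive net g H a S P) (hH : IsHamiltonianWalk H)
    (ha : ∀ t i j, a t i j ≤ K) (t : ℕ) : maxWeight (net.run S a t).queue
      ≤ weight (net.run S a t).queue (P t) + 2 * N ! * (N * N * (K + 1)) := by
  obtain ⟨σ, hσ⟩ := exists_weight_eq_maxWeight (net.run S a t).queue
  rw [← hσ]
  obtain ⟨s, ⟨hs, hHs⟩, -⟩ := hH.visits σ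
  have hone := (isSchedule_permMatrix σ).le_one
  rcases lt_or_ge t s with hts | hts
  -- Before the first visit to `σ` the queues are still short, as the network starts empty.
  · have h1 := weight_run_add_le (net := net) (S := S) ha hone 0 t
    have h2 : weight (net.run S a 0).queue (σ.permMatrix ℕ) = 0 := by
      simp [weight, Network.run_queue_zero]
    have h3 : t * (N * N * (K + 1)) ≤ 2 * N ! * (N * N * (K + 1)) :=
      Nat.mul_le_mul_right _ (by omega)
    rw [zero_add] at h1
    omega
  -- `u` below is the last visit to `σ` up to slot `t`. In the fewer than `N !` slots since then,
  -- the weight of `σ` rose and that of the proposal fell by at most one unit per slot, whence the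
  -- factor `2`.
  · set k := (t - s) / N ! with hk
    have hfac : 0 < N ! := Nat.factorial_pos N
    have h1 : N ! * k + (t - s) % N ! = t - s := Nat.div_add_mod _ _
    have h2 := Nat.mod_lt (t - s) hfac
    obtain ⟨r, hr⟩ : ∃ r, t = (s + N ! * k) + r := ⟨(t - s) % N !, by omega⟩
    have hrlt : r < N ! := by omega
    set u := s + N ! * k with hu
    have h3 := h.proposal_ge u
    rw [hu, hH.apply_add_mul, hHs, ← hu] at h3
    have h4 := h.weight_proposal_le K u r
    have h5 := weight_run_add_le (net := net) (S := S) ha hone u r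
    have h6 : r * (N * N * (K + 1)) ≤ N ! * (N * N * (K + 1)) :=
      Nat.mul_le_mul_right _ hrlt.le
    rw [← hr] at h4 h5
    rw [mul_assoc 2]
    omega

theorem eq_or_eq (h : IsAdaptive net g H a S P) (t : ℕ) :
    S t = (net.run S a t).schedule ∨ S t = P t := by
  rw [h.choice t]
  unfold adaptiveChoice
  split_ifs
  exacts [Or.inl rfl, Or.inr rfl]

theorem lt_of_ne (h : IsAdaptive net g H a S P) {t : ℕ} (hne : S t ≠ (net.run S a t).schedule) :
    S t = P t ∧ g (weight (net.run S a t).queue (P t))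
      < (weight (net.run S a t).queue (P t) : ℝ)
        - weight (net.run S a t).queue (net.run S a t).schedule := by
  have hc := h.choice t
  unfold adaptiveChoice at hc
  split_ifs at hc with hif
  · exact absurd hc hne
  · exact ⟨hc, not_le.1 hif⟩

theorem weight_proposal_sub_le (h : IsAdaptive net g H a S P) (hg : IsHysteresis g) (t : ℕ) :
    (weight (net.run S a t).queue (P t) : ℝ) - weight (net.run S a t).queue (S t)
      ≤ g (weight (net.run S a t).queue (P t)) := by
  by_cases hif : (weight (net.run S a t).queue (P t) : ℝ)
      - weight (net.run S a t).queue (net.run S a t).schedule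
        ≤ g (weight (net.run S a t).queue (P t))
  · have : S t = (net.run S a t).schedule := by
      rw [h.choice t]; exact if_pos hif
    rwa [this]
  · have : S t = P t := by
      rw [h.choice t]; exact if_neg hif
    rw [this, sub_self]
    exact hg.nonneg _ (Nat.cast_nonneg _)

/-- The weight of the schedule in use is almost maximal when the configuration is young. -/
theorem maxWeight_le_of_age (h : IsAdaptive net g H a S P) (hH : IsHamiltonianWalk H)
    (ha : ∀ t i j, a t i j ≤ K) (t : ℕ) {k : ℕ} (hk : (net.run S a (t + 1)).age = some k) :
    maxWeight (net.run S a t).queue ≤ weight (net.run S a t).queue (S t)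
      + (2 * k + 2 * N !) * (N * N * (K + 1)) := by
  induction t generalizing k with
  | zero =>
    have : maxWeight (net.run S a 0).queue = 0 := by
      obtain ⟨σ, hσ⟩ := exists_weight_eq_maxWeight (net.run S a 0).queue
      rw [← hσ]
      simp [weight, Network.run_queue_zero]
    omega
  | succ t ih =>
    have hage : (net.run S a (t + 1)).newAge (S (t + 1)) = some k := hk
    unfold NetState.newAge at hage
    split_ifs at hage with heq
    · obtain ⟨m, hm, rfl⟩ := Option.map_eq_some_iff.1 hage
      have h1 := ih hm
      have h2 := maxWeight_run_succ_le (net := net) (S := S) ha t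
      have h3 := weight_run_le_add (a := a) h.feasible K
        (net.isSchedule _ (h.feasible t)).le_one t 1
      have heq' : S (t + 1) = S t := heq
      rw [heq']
      rw [one_mul] at h3
      have : (2 * (m + 1) + 2 * N !) * (N * N * (K + 1))
          = (2 * m + 2 * N !) * (N * N * (K + 1)) + 2 * (N * N * (K + 1)) := by ring
      omega
    · have hk0 : 0 = k := Option.some.inj hage
      subst hk0
      rw [(h.lt_of_ne heq).1]
      simpa using h.maxWeight_le_proposal hH ha (t + 1)

end IsAdaptive

end Adaptive

/-! ### Linear bounds for hysteresis functions -/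

namespace IsHysteresis

variable {g : ℝ → ℝ}

theorem mono (hg : IsHysteresis g) {x y : ℝ} (hx : 0 ≤ x) (hxy : x ≤ y) : g x ≤ g y :=
  hg.strictMonoOn.monotoneOn hx (hx.trans hxy) hxy

/-- Sublinearity gives the bound beyond some `z`, and monotonicity bounds `g` by `g z` before. -/
theorem exists_le_linear (hg : IsHysteresis g) {η : ℝ} (hη : 0 < η) :
    ∃ G, 0 ≤ G ∧ ∀ x, 0 ≤ x → g x ≤ η * x + G := by
  obtain ⟨y, hy⟩ := eventually_atTop.1 (hg.sublinear.eventually (ge_mem_nhds hη))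
  set z := max y 1
  have hz : 0 < z := lt_of_lt_of_le one_pos (le_max_right _ _)
  refine ⟨g z, hg.nonneg _ hz.le, fun x hx => ?_⟩
  rcases le_total x z with h | h
  · exact (hg.mono hx h).trans (le_add_of_nonneg_left (by positivity))
  · have h1 := hy x ((le_max_left _ _).trans h)
    have h2 : g x ≤ η * x := (div_le_iff₀ (hz.trans_le h)).1 h1
    linarith [hg.nonneg _ hz.le]

end IsHysteresis

/-! ### Arrival rates in the interior of the capacity region -/

section Interior

variable {N : ℕ} {net : Network N} {g : ℝ → ℝ} {H : ℕ → Equiv.Perm (Fin N)}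
  {S a P : ℕ → NatMat N} {K : ℕ}

/-- The factor of the largest weight in the Lyapunov function. It falls steeply during the `d + 1`
slots that are lost to a reconfiguration, and recovers slowly afterwards. -/
noncomputable def agePotential (ε : ℝ) (d : ℕ) : Option ℕ → ℝ
  | none => 3 * d + 3
  | some k => max (3 * ((d : ℝ) - k)) (min (ε / 2 * ((k : ℝ) - d)) (3 * d + 3))

theorem agePotential_nonneg {ε : ℝ} (hε : 0 < ε) (d : ℕ) (k : Option ℕ) :
    0 ≤ agePotential ε d k := by
  cases k with
  | none => simp only [agePotential]; positivity
  | some k =>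
    simp only [agePotential]
    rcases le_total (k : ℝ) d with h | h
    · exact le_max_of_le_left (by linarith)
    · exact le_max_of_le_right (le_min (mul_nonneg (by linarith) (by linarith)) (by positivity))

theorem agePotential_le {ε : ℝ} (d : ℕ) (k : Option ℕ) :
    agePotential ε d k ≤ 3 * d + 3 := by
  cases k with
  | none => exact le_rfl
  | some k =>
    have : (0 : ℝ) ≤ k := Nat.cast_nonneg k
    exact max_le (by linarith) (min_le_right _ _)

/-- The recovery is slow enough to be paid from the negative drift of the slots with service. -/
theorem agePotential_map_succ_le {ε : ℝ} (hε : 0 < ε) (d : ℕ) (k : Option ℕ) :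
    agePotential ε d (k.map (· + 1)) ≤ agePotential ε d k + ε / 2 := by
  cases k with
  | none => simp only [Option.map_none]; linarith
  | some k =>
    simp only [agePotential, Option.map_some]
    push_cast
    refine max_le ?_ ?_
    · exact le_add_of_le_of_nonneg ((by linarith : _ ≤ 3 * ((d : ℝ) - k)).trans
        (le_max_left _ _)) (by linarith)
    · have h1 := le_max_right (3 * ((d : ℝ) - k)) (min (ε / 2 * ((k : ℝ) - d)) (3 * d + 3))
      have h2 : min (ε / 2 * ((k : ℝ) + 1 - d)) (3 * d + 3)
          ≤ min (ε / 2 * ((k : ℝ) - d)) (3 * d + 3) + ε / 2 := by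
        rw [← min_add_add_right]
        exact min_le_min (by linarith) (by linarith)
      linarith

/-- A slot without service costs the squares up to `2 * (1 - ε)` times the largest weight, and the
drift estimate asks for `ε` more; a fall by `3` covers both. -/
theorem agePotential_succ_le {ε : ℝ} (hε : 0 < ε) {d k : ℕ} (h : k + 1 ≤ d) :
    agePotential ε d (some (k + 1)) ≤ agePotential ε d (some k) - 3 := by
  have h' : (k : ℝ) + 1 ≤ d := by exact_mod_cast h
  simp only [agePotential]
  push_cast
  refine max_le ?_ ?_
  · have := le_max_left (3 * ((d : ℝ) - k)) (min (ε / 2 * ((k : ℝ) - d)) (3 * d + 3))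
    linarith
  · have := le_max_left (3 * ((d : ℝ) - k)) (min (ε / 2 * ((k : ℝ) - d)) (3 * d + 3))
    refine (min_le_left _ _).trans ?_
    nlinarith

/-- A reconfiguration from the saturated value `3 * d + 3` thus also lowers the potential by `3`. -/
theorem agePotential_zero_le {ε : ℝ} (hε : 0 < ε) (d : ℕ) :
    agePotential ε d (some 0) ≤ 3 * d := by
  simp only [agePotential]
  push_cast
  have : (0 : ℝ) ≤ d := Nat.cast_nonneg d
  refine max_le (by linarith) ((min_le_left _ _).trans ?_)
  nlinarith

theorem agePotential_of_le {ε : ℝ} (hε : 0 < ε) {d T k : ℕ}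
    (hT : 3 * (d : ℝ) + 3 ≤ ε / 2 * ((T : ℝ) - d)) (hk : T ≤ k) :
    agePotential ε d (some k) = 3 * d + 3 := by
  refine le_antisymm (agePotential_le d _) (le_max_of_le_right (le_min (hT.trans ?_) le_rfl))
  have : (T : ℝ) ≤ k := by exact_mod_cast hk
  nlinarith

/-- The sum of the squares of the queue lengths. -/
def sumSq (L : NatMat N) : ℝ := ∑ i, ∑ j, (L i j : ℝ) ^ 2

theorem sumSq_run_succ_le (hS : ∀ t, S t ∈ net.feasible) (ha : ∀ t i j, a t i j ≤ K) (t : ℕ) :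
    sumSq (net.run S a (t + 1)).queue ≤ sumSq (net.run S a t).queue
      + 2 * (∑ i, ∑ j, ((net.run S a t).queue i j : ℝ) * a t i j)
      - 2 * (∑ i, ∑ j, ((net.run S a t).queue i j : ℝ)
        * net.departures (net.run S a t) (S t) i j) + N * N * (K + 1) ^ 2 := by
  have hB : (N * N * (K + 1) ^ 2 : ℝ) = ∑ _i : Fin N, ∑ _j : Fin N, ((K : ℝ) + 1) ^ 2 := by
    simp [mul_assoc]
  simp only [sumSq, hB, Finset.mul_sum, ← Finset.sum_add_distrib, ← Finset.sum_sub_distrib]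
  refine Finset.sum_le_sum fun i _ => Finset.sum_le_sum fun j _ => ?_
  have h1 : ((net.run S a (t + 1)).queue i j : ℝ)
      = (net.run S a t).queue i j + a t i j - net.departures (net.run S a t) (S t) i j := by
    have := Network.run_queue_succ_add (a := a) hS t i j
    rw [eq_sub_iff_add_eq]
    exact_mod_cast this
  have h2 : (net.departures (net.run S a t) (S t) i j : ℝ) ≤ 1 := by
    exact_mod_cast (Network.departures_le_schedule (net := net) (net.run S a t) (S t) i j).trans
      ((net.isSchedule _ (hS t)).le_one i j)
  have h3 : (a t i j : ℝ) ≤ K := by exact_mod_cast ha t i j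
  have h4 : (0 : ℝ) ≤ net.departures (net.run S a t) (S t) i j := Nat.cast_nonneg _
  have h5 : (0 : ℝ) ≤ a t i j := Nat.cast_nonneg _
  have h6 : ((a t i j : ℝ) - net.departures (net.run S a t) (S t) i j) ^ 2 ≤ ((K : ℝ) + 1) ^ 2 :=
    sq_le_sq' (by linarith) (by linarith)
  rw [h1]
  nlinarith

/-- The Lyapunov function of the adaptive Hamiltonian policy. -/
noncomputable def lyapunov (ε : ℝ) (d : ℕ) (x : NetState N) : ℝ :=
  sumSq x.queue + maxWeight x.queue * agePotential ε d x.age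

theorem lyapunov_nonneg {ε : ℝ} (hε : 0 < ε) (d : ℕ) (x : NetState N) : 0 ≤ lyapunov ε d x :=
  add_nonneg (Finset.sum_nonneg fun _ _ => Finset.sum_nonneg fun _ _ => sq_nonneg _)
    (mul_nonneg (Nat.cast_nonneg _) (agePotential_nonneg hε d _))

/-- A reconfiguration in a slot with long queues comes long after the previous one. -/
theorem IsAdaptive.agePotential_of_ne (h : IsAdaptive net g H a S P) (hg : IsHysteresis g)
    (hH : IsHamiltonianWalk H) (ha : ∀ t i j, a t i j ≤ K) {ε : ℝ} (hε : 0 < ε) {d T : ℕ}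
    (hT : 3 * (d : ℝ) + 3 ≤ ε / 2 * ((T : ℝ) - d)) {y : ℝ} (hy : 0 ≤ y)
    (hgy : ((2 * T + 2 * N !) * (N * N * (K + 1)) : ℕ) ≤ g y) {t : ℕ}
    (hne : S t ≠ (net.run S a t).schedule)
    (hw : y + (2 * N ! * (N * N * (K + 1)) : ℕ) ≤ maxWeight (net.run S a t).queue) :
    agePotential ε d (net.run S a t).age = 3 * d + 3 := by
  rcases hage : (net.run S a t).age with _ | m
  · rfl
  refine agePotential_of_le hε hT ?_
  by_contra hlt
  push Not at hlt
  cases t with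
  | zero => simp [Network.run, Network.init] at hage
  | succ t =>
    have h1 := h.maxWeight_le_of_age hH ha t hage
    have h2 := maxWeight_run_succ_le (net := net) (S := S) ha t
    have h3 := weight_run_le_add (a := a) h.feasible K
        (net.isSchedule _ (h.feasible t)).le_one t 1
    rw [one_mul] at h3
    have h4 := (h.lt_of_ne hne).2
    have h5 := h.maxWeight_le_proposal hH ha (t + 1)
    have h6 := (h.isSchedule (t + 1)).weight_le_maxWeight (net.run S a (t + 1)).queue
    have hs : (net.run S a (t + 1)).schedule = S t := rfl
    rw [hs] at h4
    have h7 : y ≤ weight (net.run S a (t + 1)).queue (P (t + 1)) := by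
      have : (maxWeight (net.run S a (t + 1)).queue : ℝ)
          ≤ (weight (net.run S a (t + 1)).queue (P (t + 1)) : ℝ)
            + (2 * N ! * (N * N * (K + 1)) : ℕ) := by exact_mod_cast h5
      linarith
    have h8 := hg.mono hy h7
    -- As `m < T`, the schedule at slot `t` lacks at most `2 * m + 2 * N !` units of the maximal
    -- weight, and one slot adds two. This is within the threshold `g y`, so the reconfiguration
    -- would not have happened.
    have h9 : weight (net.run S a (t + 1)).queue (P (t + 1))
        ≤ weight (net.run S a (t + 1)).queue (S t) + (2 * T + 2 * N !) * (N * N * (K + 1)) := by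
      have h10 : (2 * m + 2 * N !) * (N * N * (K + 1)) + 2 * (N * N * (K + 1))
          = (2 * (m + 1) + 2 * N !) * (N * N * (K + 1)) := by ring
      have h11 : (2 * (m + 1) + 2 * N !) * (N * N * (K + 1))
          ≤ (2 * T + 2 * N !) * (N * N * (K + 1)) := Nat.mul_le_mul_right _ (by omega)
      omega
    have h12 : (weight (net.run S a (t + 1)).queue (P (t + 1)) : ℝ)
        ≤ (weight (net.run S a (t + 1)).queue (S t) : ℝ)
          + ((2 * T + 2 * N !) * (N * N * (K + 1)) : ℕ) := by exact_mod_cast h9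
    linarith

theorem Network.blocked_iff (hdelay : 0 < net.delay) (x : NetState N) (R : NatMat N) :
    net.Blocked x R ↔ ∃ k ∈ x.newAge R, k ≤ ⌊net.delay⌋₊ := by
  simp only [Network.Blocked, Nat.le_floor_iff hdelay.le]

open Classical in
/-- The drift of the Lyapunov function along sample paths. -/
theorem exists_lyapunov_drift (net : Network N) (hdelay : 0 < net.delay) (hg : IsHysteresis g)
    (hH : IsHamiltonianWalk H) (K : ℕ) (r : Matrix (Fin N) (Fin N) ℝ) {ε : ℝ} (hε : 0 < ε)
    (hε1 : ε < 1) (h0 : ∀ i j, 0 ≤ r i j) (hr : ∀ i, ∑ j, r i j ≤ 1 - ε)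
    (hc : ∀ j, ∑ i, r i j ≤ 1 - ε) :
    ∃ C, ∀ a S P : ℕ → NatMat N, IsAdaptive net g H a S P → (∀ t i j, a t i j ≤ K) → ∀ t,
      lyapunov ε ⌊net.delay⌋₊ (net.run S a (t + 1)) + ε * maxWeight (net.run S a t).queue
        ≤ lyapunov ε ⌊net.delay⌋₊ (net.run S a t) + C
          + 2 * ∑ i, ∑ j, ((net.run S a t).queue i j : ℝ) * ((a t i j : ℝ) - r i j) := by
  set d := ⌊net.delay⌋₊ with hd
  -- In a slot with service the drift is `-2 * ε` times the largest weight before corrections: `ε`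
  -- is kept for the claim, `ε / 2` pays for the recovery of the potential, and `2 * (ε / 4)` for
  -- the hysteresis.
  obtain ⟨G, hG0, hG⟩ := hg.exists_le_linear (show 0 < ε / 4 by positivity)
  -- From age `T` on the potential is saturated; `y` is a weight at which the threshold forbids
  -- reconfiguring earlier.
  obtain ⟨T, hT⟩ := exists_nat_ge ((3 * (d : ℝ) + 3) / (ε / 2) + d)
  replace hT : 3 * (d : ℝ) + 3 ≤ ε / 2 * ((T : ℝ) - d) := by
    rw [← div_le_iff₀' (by positivity)]
    linarith
  obtain ⟨y, hgy, hy⟩ := ((hg.unbounded.eventually_ge_atTop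
    (((2 * T + 2 * N !) * (N * N * (K + 1)) : ℕ) : ℝ)).and (eventually_ge_atTop 0)).exists
  set c : ℝ := ((N * N * (K + 1) : ℕ) : ℝ) with hcdef
  set h₀ : ℝ := ((2 * N ! * (N * N * (K + 1)) : ℕ) : ℝ) with hh₀
  have hc0 : 0 ≤ c := Nat.cast_nonneg _
  have hh0 : 0 ≤ h₀ := Nat.cast_nonneg _
  have hd0 : (0 : ℝ) ≤ d := Nat.cast_nonneg _
  -- The terms account for the squared increments, the defect of the proposal, the offset of the
  -- linear bound for `g`, the growth of the largest weight times the potential, and lost slots with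
  -- short queues.
  refine ⟨N * N * (K + 1) ^ 2 + 2 * h₀ + 2 * G + (3 * d + 3) * c + (3 * d + 5) * (y + h₀), ?_⟩
  intro a S P h ha t
  have hV := sumSq_run_succ_le (a := a) h.feasible ha t
  have hw' : (maxWeight (net.run S a (t + 1)).queue : ℝ)
      ≤ maxWeight (net.run S a t).queue + c := by
    rw [hcdef]
    exact_mod_cast maxWeight_run_succ_le (net := net) (S := S) ha t
  have hage : (net.run S a (t + 1)).age = (net.run S a t).newAge (S t) := rfl
  have hrate := sum_mul_le_mul_maxWeight (net.run S a t).queue r (sub_pos.2 hε1) h0 hr hc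
  have hsplit : ∑ i, ∑ j, ((net.run S a t).queue i j : ℝ) * ((a t i j : ℝ) - r i j)
      = ∑ i, ∑ j, ((net.run S a t).queue i j : ℝ) * a t i j
        - ∑ i, ∑ j, ((net.run S a t).queue i j : ℝ) * r i j := by
    simp only [mul_sub, Finset.sum_sub_distrib]
  rw [hsplit]
  unfold lyapunov
  rw [hage]
  have hψ0 := agePotential_nonneg hε d ((net.run S a t).newAge (S t))
  have hψ1 := agePotential_le (ε := ε) d ((net.run S a t).newAge (S t))
  have hψ2 := agePotential_nonneg hε d (net.run S a t).age
  have hw0 : (0 : ℝ) ≤ maxWeight (net.run S a t).queue := Nat.cast_nonneg _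
  have hdep0 : 0 ≤ ∑ i, ∑ j, ((net.run S a t).queue i j : ℝ)
      * net.departures (net.run S a t) (S t) i j :=
    Finset.sum_nonneg fun _ _ => Finset.sum_nonneg fun _ _ => by positivity
  have hmul1 : (maxWeight (net.run S a (t + 1)).queue : ℝ)
      * agePotential ε d ((net.run S a t).newAge (S t))
      ≤ maxWeight (net.run S a t).queue * agePotential ε d ((net.run S a t).newAge (S t))
        + (3 * d + 3) * c := by
    calc _ ≤ ((maxWeight (net.run S a t).queue : ℝ) + c)
          * agePotential ε d ((net.run S a t).newAge (S t)) := by gcongr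
      _ = maxWeight (net.run S a t).queue * agePotential ε d ((net.run S a t).newAge (S t))
          + agePotential ε d ((net.run S a t).newAge (S t)) * c := by ring
      _ ≤ _ := by gcongr
  by_cases hb : net.Blocked (net.run S a t) (S t)
  · -- the service of this slot is lost
    rcases le_total (y + h₀) (maxWeight (net.run S a t).queue) with hbig | hsmall
    · have hdrop : agePotential ε d ((net.run S a t).newAge (S t))
          ≤ agePotential ε d (net.run S a t).age - 3 := by
        obtain ⟨k, hk, hkd⟩ := (Network.blocked_iff hdelay _ _).1 hb
        by_cases heq : S t = (net.run S a t).schedule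
        · have hk' : (net.run S a t).newAge (S t) = (net.run S a t).age.map (· + 1) := by
            simp [NetState.newAge, heq]
          rw [hk'] at hk ⊢
          obtain ⟨m, hm, rfl⟩ := Option.map_eq_some_iff.1 hk
          rw [hm]
          exact agePotential_succ_le hε hkd
        · have hk' : (net.run S a t).newAge (S t) = some 0 := by
            simp [NetState.newAge, heq]
          rw [hk', h.agePotential_of_ne hg hH ha hε hT hy hgy heq hbig]
          have := agePotential_zero_le hε d
          linarith
      have hmul2 : (maxWeight (net.run S a t).queue : ℝ)
          * agePotential ε d ((net.run S a t).newAge (S t))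
          ≤ maxWeight (net.run S a t).queue * (agePotential ε d (net.run S a t).age - 3) := by
        gcongr
      have hmul3 : 0 ≤ (3 * d + 5) * (y + h₀) := by positivity
      have hmul4 : 0 ≤ ε * maxWeight (net.run S a t).queue := by positivity
      linarith
    · have hmul2 : (maxWeight (net.run S a t).queue : ℝ)
          * agePotential ε d ((net.run S a t).newAge (S t)) ≤ (y + h₀) * (3 * d + 3) := by
        gcongr
      have hmul3 : 0 ≤ (maxWeight (net.run S a t).queue : ℝ)
          * agePotential ε d (net.run S a t).age := by positivity
      have hmul4 : 0 ≤ ε * maxWeight (net.run S a t).queue := by positivity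
      linarith
  · -- the schedule of almost maximal weight is served
    have hserve : ∑ i, ∑ j, ((net.run S a t).queue i j : ℝ)
        * net.departures (net.run S a t) (S t) i j
        = weight (net.run S a t).queue (S t) := by
      rw [weight]
      push_cast
      refine Finset.sum_congr rfl fun i _ => Finset.sum_congr rfl fun j _ => ?_
      exact_mod_cast Network.queue_mul_departures hb i j
    have h1 := h.weight_proposal_sub_le hg t
    have h2 : (weight (net.run S a t).queue (P t) : ℝ) ≤ maxWeight (net.run S a t).queue := by
      exact_mod_cast (h.isSchedule t).weight_le_maxWeight _
    have h3 := hg.mono (Nat.cast_nonneg _) h2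
    have h4 := hG _ hw0
    have h5 : (maxWeight (net.run S a t).queue : ℝ)
        ≤ weight (net.run S a t).queue (P t) + h₀ := by
      rw [hh₀]
      exact_mod_cast h.maxWeight_le_proposal hH ha t
    have heq : S t = (net.run S a t).schedule := by
      by_contra hne
      refine hb ((Network.blocked_iff hdelay _ _).2 ⟨0, ?_, Nat.zero_le _⟩)
      simp [NetState.newAge, hne]
    have hk' : (net.run S a t).newAge (S t) = (net.run S a t).age.map (· + 1) := by
      simp [NetState.newAge, heq]
    have h6 := agePotential_map_succ_le hε d (net.run S a t).age
    rw [← hk'] at h6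
    have hmul2 : (maxWeight (net.run S a t).queue : ℝ)
        * agePotential ε d ((net.run S a t).newAge (S t))
        ≤ maxWeight (net.run S a t).queue * (agePotential ε d (net.run S a t).age + ε / 2) := by
      gcongr
    have hmul3 : 0 ≤ (3 * d + 5) * (y + h₀) := by positivity
    rw [hserve] at hV
    linarith

end Interior

/-! ### Mean queue lengths -/

section Stability

variable {N : ℕ} {net : Network N} {Ω : Type*} [MeasurableSpace Ω] {μ : Measure Ω}
  {A : ℕ → Ω → NatMat N}

theorem SchedulingPolicy.dependsOn_run (π : SchedulingPolicy net) (t : ℕ) :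
    DependsOn (fun a => net.run (π.schedule a) a t) (Set.Iio t) := fun a a' h =>
  Network.run_congr (fun τ hτ => π.causal a a' τ fun s hs => h s (lt_of_le_of_lt hs hτ))
    fun τ hτ => h τ hτ

/-- The mean of the total queue length. -/
noncomputable def SchedulingPolicy.meanLength (π : SchedulingPolicy net) (μ : Measure Ω)
    (A : ℕ → Ω → NatMat N) (t : ℕ) : ℝ :=
  ∫ ω, (totalLength (π.queue A t ω) : ℝ) ∂μ

theorem SchedulingPolicy.meanLength_nonneg (π : SchedulingPolicy net) (t : ℕ) :
    0 ≤ π.meanLength μ A t :=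
  integral_nonneg fun _ => Nat.cast_nonneg _

theorem IsTraffic.integrable_run [IsProbabilityMeasure μ] (hA : IsTraffic μ A)
    (π : SchedulingPolicy net) (t : ℕ) (f : NetState N → ℝ) :
    Integrable (fun ω => f (net.run (π.schedule fun τ => A τ ω) (fun τ => A τ ω) t)) μ :=
  hA.integrable_of_dependsOn (t := t)
    (F := fun a => f (net.run (π.schedule a) a t)) fun _ _ h =>
      congrArg f (π.dependsOn_run t h)

theorem IsTraffic.lintegral_totalLength [IsProbabilityMeasure μ] (hA : IsTraffic μ A)
    (π : SchedulingPolicy net) (t : ℕ) :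
    ∫⁻ ω, (totalLength (π.queue A t ω) : ℝ≥0∞) ∂μ = ENNReal.ofReal (π.meanLength μ A t) := by
  have h := ofReal_integral_eq_lintegral_ofReal
    (hA.integrable_run π t fun x => (totalLength x.queue : ℝ))
    (Eventually.of_forall fun _ => Nat.cast_nonneg _)
  simp only [ENNReal.ofReal_natCast] at h
  exact h.symm

theorem IsTraffic.cesaro_eq [IsProbabilityMeasure μ] (hA : IsTraffic μ A)
    (π : SchedulingPolicy net) {t : ℕ} (ht : 0 < t) :
    (∑ τ ∈ Finset.range t, ∫⁻ ω, (totalLength (π.queue A τ ω) : ℝ≥0∞) ∂μ) / (t : ℝ≥0∞)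
      = ENNReal.ofReal ((∑ τ ∈ Finset.range t, π.meanLength μ A τ) / t) := by
  simp only [hA.lintegral_totalLength]
  rw [← ENNReal.ofReal_sum_of_nonneg fun τ _ => π.meanLength_nonneg τ,
    ENNReal.ofReal_div_of_pos (by exact_mod_cast ht), ENNReal.ofReal_natCast]

/-- The bound has `t + 1` in place of `t` to absorb an initial constant; dividing by `t ≥ 1` costs a
factor `2`. -/
theorem IsTraffic.stronglyStable_of_sum_le [IsProbabilityMeasure μ] (hA : IsTraffic μ A)
    (π : SchedulingPolicy net) {C : ℝ}
    (h : ∀ t : ℕ, ∑ τ ∈ Finset.range t, π.meanLength μ A τ ≤ C * (t + 1)) :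
    StronglyStable π μ A := by
  have hC : 0 ≤ C := by simpa using h 0
  refine lt_of_le_of_lt (limsup_le_of_le (a := ENNReal.ofReal (2 * C)) (by isBoundedDefault) ?_)
    ENNReal.ofReal_lt_top
  filter_upwards [eventually_gt_atTop 0] with t ht
  rw [hA.cesaro_eq π ht]
  have h1 : (1 : ℝ) ≤ t := by exact_mod_cast ht
  refine ENNReal.ofReal_le_ofReal ((div_le_iff₀ (by positivity)).2 ((h t).trans ?_))
  nlinarith

/-- Every necessary condition is proved through this: if the means eventually exceed `2 * (b + 1)`,
the later half of the slots alone lifts the average above `b`. -/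
theorem IsTraffic.not_tendsto_meanLength [IsProbabilityMeasure μ] (hA : IsTraffic μ A)
    {π : SchedulingPolicy net} (h : StronglyStable π μ A) :
    ¬ Tendsto (π.meanLength μ A) atTop atTop := by
  intro htop
  obtain ⟨b, hb, hbtop⟩ := ENNReal.lt_iff_exists_nnreal_btwn.1 h
  have h1 := eventually_lt_of_limsup_lt hb
  obtain ⟨t₀, ht₀⟩ := eventually_atTop.1 (htop.eventually_ge_atTop (2 * ((b : ℝ) + 1)))
  obtain ⟨t, ht, ht2⟩ := (h1.and (eventually_ge_atTop (2 * t₀ + 1))).exists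
  have htpos : 0 < t := by omega
  have htpos' : (0 : ℝ) < t := by exact_mod_cast htpos
  rw [hA.cesaro_eq π htpos, ENNReal.ofReal_lt_iff_lt_toReal (div_nonneg (Finset.sum_nonneg
    fun τ _ => π.meanLength_nonneg τ) htpos'.le) ENNReal.coe_ne_top, ENNReal.coe_toReal,
    div_lt_iff₀ htpos'] at ht
  have h2 : ((t - t₀ : ℕ) : ℝ) * (2 * ((b : ℝ) + 1))
      ≤ ∑ τ ∈ Finset.range t, π.meanLength μ A τ := by
    calc ((t - t₀ : ℕ) : ℝ) * (2 * ((b : ℝ) + 1))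
        = ∑ _τ ∈ Finset.Ico t₀ t, 2 * ((b : ℝ) + 1) := by simp
      _ ≤ ∑ τ ∈ Finset.Ico t₀ t, π.meanLength μ A τ :=
        Finset.sum_le_sum fun τ hτ => ht₀ τ (Finset.mem_Ico.1 hτ).1
      _ ≤ _ := Finset.sum_le_sum_of_subset_of_nonneg
        (fun τ hτ => Finset.mem_range.2 (Finset.mem_Ico.1 hτ).2)
        fun τ _ _ => π.meanLength_nonneg τ
  have h3 : (t : ℝ) ≤ 2 * ((t - t₀ : ℕ) : ℝ) := by exact_mod_cast (by omega : t ≤ 2 * (t - t₀))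
  have hb0 : (0 : ℝ) ≤ b := b.2
  nlinarith

/-- A Foster-Lyapunov criterion with the drift in the mean. -/
theorem sum_le_of_drift {V f : ℕ → ℝ} {C ε : ℝ} (hV : ∀ t, 0 ≤ V t)
    (h : ∀ t, V (t + 1) + ε * f t ≤ V t + C) (t : ℕ) :
    ε * ∑ τ ∈ Finset.range t, f τ ≤ V 0 + C * t := by
  suffices V t + ε * ∑ τ ∈ Finset.range t, f τ ≤ V 0 + C * t by linarith [hV t]
  induction t with
  | zero => simp
  | succ t ih =>
    rw [Finset.sum_range_succ]
    push_cast
    linarith [h t]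

/-- The adaptive Hamiltonian policy stabilizes the network if the arrival rates lie in the interior
of the capacity region. -/
theorem stronglyStable_of_rate_le [IsProbabilityMeasure μ] (hA : IsTraffic μ A)
    (hnet : net.NonBlocking) (hdelay : 0 < net.delay) {g : ℝ → ℝ} (hg : IsHysteresis g)
    {H : ℕ → Equiv.Perm (Fin N)} (hH : IsHamiltonianWalk H) {P₀ : NatMat N}
    (hP₀ : P₀ ∈ net.feasible) {ε : ℝ} (hε : 0 < ε) (hε1 : ε < 1)
    (hr : ∀ i, ∑ j, arrivalRate μ A i j ≤ 1 - ε)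
    (hc : ∀ j, ∑ i, arrivalRate μ A i j ≤ 1 - ε) :
    StronglyStable (AdaptiveHamiltonian.policy g H hnet hP₀) μ A := by
  set π := AdaptiveHamiltonian.policy g H hnet hP₀ with hπ
  obtain ⟨K, hK⟩ := hA.ae_bounded
  obtain ⟨C, hC⟩ := exists_lyapunov_drift net hdelay hg hH K (arrivalRate μ A) hε hε1
    (fun i j => arrivalRate_nonneg i j) hr hc
  set d := ⌊net.delay⌋₊
  let x : ℕ → Ω → NetState N := fun t ω =>
    net.run (π.schedule fun τ => A τ ω) (fun τ => A τ ω) t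
  have hint : ∀ t (f : NetState N → ℝ), Integrable (fun ω => f (x t ω)) μ :=
    fun t f => hA.integrable_run π t f
  have hcross : ∀ t i j, Integrable (fun ω => ((x t ω).queue i j : ℝ)
      * ((A t ω i j : ℝ) - arrivalRate μ A i j)) μ := fun t i j =>
    hA.integrable_of_dependsOn (t := t + 1) (F := fun a =>
      ((net.run (π.schedule a) a t).queue i j : ℝ) * ((a t i j : ℝ) - arrivalRate μ A i j))
      fun a a' h => by
        simp only [(π.dependsOn_run t).of_le (Nat.le_succ t) h, h t (Nat.lt_succ_self t)]
  -- The queues at the beginning of slot `t` are independent of the centred arrivals in it.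
  have hzero : ∀ t, ∫ ω, ∑ i, ∑ j, ((x t ω).queue i j : ℝ)
      * ((A t ω i j : ℝ) - arrivalRate μ A i j) ∂μ = 0 := by
    intro t
    rw [integral_finsetSum _ fun i _ => integrable_finsetSum _ fun j _ => hcross t i j]
    refine Finset.sum_eq_zero fun i _ => ?_
    rw [integral_finsetSum _ fun j _ => hcross t i j]
    refine Finset.sum_eq_zero fun j _ => ?_
    have h1 : ∫ ω, ((A t ω i j : ℝ) - arrivalRate μ A i j) ∂μ = 0 := by
      rw [integral_sub (hA.integrable_eval t fun M => (M i j : ℝ)) (integrable_const _),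
        hA.integral_arrival]
      simp
    have h2 := hA.integral_mul (t := t)
      (F := fun a => ((net.run (π.schedule a) a t).queue i j : ℝ))
      (fun a a' h => by simp only [π.dependsOn_run t h])
      (fun M => (M i j : ℝ) - arrivalRate μ A i j)
    rw [h1, mul_zero] at h2
    exact h2
  have hdrift : ∀ t, (∫ ω, lyapunov ε d (x (t + 1) ω) ∂μ)
      + ε * ∫ ω, (maxWeight (x t ω).queue : ℝ) ∂μ ≤ (∫ ω, lyapunov ε d (x t ω) ∂μ) + C := by
    intro t
    have hsum : Integrable (fun ω => ∑ i, ∑ j, ((x t ω).queue i j : ℝ)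
      * ((A t ω i j : ℝ) - arrivalRate μ A i j)) μ :=
      integrable_finsetSum _ fun i _ => integrable_finsetSum _ fun j _ => hcross t i j
    have hW : Integrable (fun ω => (maxWeight (x t ω).queue : ℝ)) μ :=
      hint t fun x => (maxWeight x.queue : ℝ)
    have := integral_mono_ae (μ := μ)
      (f := fun ω => lyapunov ε d (x (t + 1) ω) + ε * (maxWeight (x t ω).queue : ℝ))
      (g := fun ω => lyapunov ε d (x t ω) + C + 2 * ∑ i, ∑ j, ((x t ω).queue i j : ℝ)
        * ((A t ω i j : ℝ) - arrivalRate μ A i j))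
      ((hint _ _).add (hW.const_mul _))
      (((hint _ _).add (integrable_const _)).add (hsum.const_mul _)) (by
        filter_upwards [hK] with ω hω
        exact hC _ _ _ (AdaptiveHamiltonian.isAdaptive g H hnet hP₀ _) hω t)
    rw [integral_add (hint _ _) (hW.const_mul _), integral_const_mul,
      integral_add (f := fun ω => lyapunov ε d (x t ω) + C)
        ((hint t _).add (integrable_const C)) (hsum.const_mul 2),
      integral_add (hint _ _) (integrable_const _), integral_const_mul, hzero] at this
    simpa using this
  have hsum := sum_le_of_drift (V := fun t => ∫ ω, lyapunov ε d (x t ω) ∂μ)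
    (fun t => integral_nonneg fun ω => lyapunov_nonneg hε d _) hdrift
  have hmean : ∀ t, π.meanLength μ A t ≤ N * N * ∫ ω, (maxWeight (x t ω).queue : ℝ) ∂μ := by
    intro t
    rw [← integral_const_mul]
    refine integral_mono (hint t fun x => (totalLength x.queue : ℝ))
      ((hint t fun x => (maxWeight x.queue : ℝ)).const_mul _) fun ω => ?_
    have h : (totalLength (x t ω).queue : ℝ) ≤ N * N * maxWeight (x t ω).queue := by
      exact_mod_cast totalLength_le_mul_maxWeight (x t ω).queue
    exact h
  set V₀ := ∫ ω, lyapunov ε d (x 0 ω) ∂μ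
  refine hA.stronglyStable_of_sum_le π (C := N * N * ((|V₀| + |C|) / ε)) fun t => ?_
  calc ∑ τ ∈ Finset.range t, π.meanLength μ A τ
      ≤ ∑ τ ∈ Finset.range t, (N * N * ∫ ω, (maxWeight (x τ ω).queue : ℝ) ∂μ) :=
        Finset.sum_le_sum fun τ _ => hmean τ
    _ = N * N * ∑ τ ∈ Finset.range t, ∫ ω, (maxWeight (x τ ω).queue : ℝ) ∂μ := by
        rw [Finset.mul_sum]
    _ ≤ N * N * ((|V₀| + |C|) / ε * (t + 1)) := by
        gcongr
        rw [div_mul_eq_mul_div, le_div_iff₀' hε]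
        refine (hsum t).trans ?_
        have ht : (0 : ℝ) ≤ t := Nat.cast_nonneg t
        have h1 := le_abs_self V₀
        have h2 : C * t ≤ |C| * t := mul_le_mul_of_nonneg_right (le_abs_self C) ht
        have h3 := abs_nonneg C
        have h4 : 0 ≤ |V₀| * t := by positivity
        linarith
    _ = _ := by ring

end Stability

set_option linter.unusedSectionVars false

/-! ### Necessary conditions for strong stability -/

/-! ### Centred random walks -/

section Walk

variable {N : ℕ} {Ω : Type*} [MeasurableSpace Ω] {μ : Measure Ω} [IsProbabilityMeasure μ]
  {A : ℕ → Ω → NatMat N}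

theorem dependsOn_sum_range (Y : NatMat N → ℝ) (t : ℕ) :
    DependsOn (fun a : ℕ → NatMat N => ∑ s ∈ Finset.range t, Y (a s)) (Set.Iio t) :=
  fun _ _ h => Finset.sum_congr rfl fun s hs => by rw [h s (Finset.mem_range.1 hs)]

/-- The second and the fourth moments of a random walk with bounded centred steps. -/
theorem IsTraffic.walk_moments (hA : IsTraffic μ A) {Y : NatMat N → ℝ} {K v : ℝ}
    (h0 : ∀ t, ∫ ω, Y (A t ω) ∂μ = 0) (hK : ∀ t, ∀ᵐ ω ∂μ, |Y (A t ω)| ≤ K)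
    (hv : ∀ t, v ≤ ∫ ω, Y (A t ω) ^ 2 ∂μ) (t : ℕ) :
    v * t ≤ ∫ ω, (∑ s ∈ Finset.range t, Y (A s ω)) ^ 2 ∂μ ∧
      ∫ ω, (∑ s ∈ Finset.range t, Y (A s ω)) ^ 2 ∂μ ≤ K ^ 2 * t ∧
      ∫ ω, (∑ s ∈ Finset.range t, Y (A s ω)) ^ 4 ∂μ ≤ 3 * K ^ 4 * t ^ 2 := by
  have hmul : ∀ t k l, ∫ ω, (∑ s ∈ Finset.range t, Y (A s ω)) ^ k * Y (A t ω) ^ l ∂μ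
      = (∫ ω, (∑ s ∈ Finset.range t, Y (A s ω)) ^ k ∂μ) * ∫ ω, Y (A t ω) ^ l ∂μ := by
    intro t k l
    refine hA.integral_mul (F := fun a => (∑ s ∈ Finset.range t, Y (a s)) ^ k)
      (fun a a' h => ?_) (fun M => Y M ^ l)
    simp only [dependsOn_sum_range Y t h]
  have hint : ∀ t k l, Integrable
      (fun ω => (∑ s ∈ Finset.range t, Y (A s ω)) ^ k * Y (A t ω) ^ l) μ := by
    intro t k l
    refine hA.integrable_of_dependsOn (t := t + 1)
      (F := fun a => (∑ s ∈ Finset.range t, Y (a s)) ^ k * Y (a t) ^ l) fun a a' h => ?_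
    simp only [(dependsOn_sum_range Y t).of_le (Nat.le_succ t) h, h t (Nat.lt_succ_self t)]
  have hpow : ∀ t l, l ≠ 0 → ∫ ω, Y (A t ω) ^ l ∂μ ≤ K ^ l := by
    intro t l hl
    calc ∫ ω, Y (A t ω) ^ l ∂μ ≤ ∫ _ω, K ^ l ∂μ := by
          refine integral_mono_ae (hA.integrable_eval t fun M => Y M ^ l) (integrable_const _) ?_
          filter_upwards [hK t] with ω hω
          exact (le_abs_self _).trans ((abs_pow _ _).le.trans
            (pow_le_pow_left₀ (abs_nonneg _) hω l))
      _ = K ^ l := by simp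
  have hM0 : ∀ t, ∫ ω, (∑ s ∈ Finset.range t, Y (A s ω)) ∂μ = 0 := by
    intro t
    rw [integral_finsetSum _ fun s _ => hA.integrable_eval s Y]
    exact Finset.sum_eq_zero fun s _ => h0 s
  -- Binomial expansion, with the new step independent of the past; terms with a first moment vanish
  -- below.
  have hM : ∀ t n, ∫ ω, (∑ s ∈ Finset.range (t + 1), Y (A s ω)) ^ n ∂μ
      = ∑ m ∈ Finset.range (n + 1), (∫ ω, (∑ s ∈ Finset.range t, Y (A s ω)) ^ m ∂μ)
        * (∫ ω, Y (A t ω) ^ (n - m) ∂μ) * n.choose m := by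
    intro t n
    simp only [Finset.sum_range_succ _ t, add_pow]
    rw [integral_finsetSum _ fun m _ => (hint t m (n - m)).mul_const _]
    simp only [integral_mul_const, hmul]
  have hM2 : ∀ t, ∫ ω, (∑ s ∈ Finset.range (t + 1), Y (A s ω)) ^ 2 ∂μ
      = ∫ ω, (∑ s ∈ Finset.range t, Y (A s ω)) ^ 2 ∂μ + ∫ ω, Y (A t ω) ^ 2 ∂μ := by
    intro t
    rw [hM, Finset.sum_range_succ, Finset.sum_range_succ, Finset.sum_range_one]
    simp [h0, add_comm]
  have hM4 : ∀ t, ∫ ω, (∑ s ∈ Finset.range (t + 1), Y (A s ω)) ^ 4 ∂μ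
      = ∫ ω, (∑ s ∈ Finset.range t, Y (A s ω)) ^ 4 ∂μ
        + (6 * ((∫ ω, (∑ s ∈ Finset.range t, Y (A s ω)) ^ 2 ∂μ) * ∫ ω, Y (A t ω) ^ 2 ∂μ)
        + ∫ ω, Y (A t ω) ^ 4 ∂μ) := by
    intro t
    rw [hM, Finset.sum_range_succ, Finset.sum_range_succ, Finset.sum_range_succ,
      Finset.sum_range_succ, Finset.sum_range_one]
    simp [h0, hM0, show Nat.choose 4 2 = 6 from rfl]
    ring
  induction t with
  | zero => simp
  | succ t ih =>
    obtain ⟨ih1, ih2, ih3⟩ := ih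
    rw [hM2, hM4]
    push_cast
    have h2 := hpow t 2 two_ne_zero
    refine ⟨by linarith [hv t], by linarith, ?_⟩
    have h4 := hpow t 4 four_ne_zero
    -- The fourth moment grows by at most `6 * K ^ 4 * t + K ^ 4`, while the claimed bound grows by
    -- `3 * K ^ 4 * (2 * t + 1)`.
    have h22 : (∫ ω, (∑ s ∈ Finset.range t, Y (A s ω)) ^ 2 ∂μ) * ∫ ω, Y (A t ω) ^ 2 ∂μ
        ≤ (K ^ 2 * t) * K ^ 2 :=
      mul_le_mul ih2 h2 (integral_nonneg fun _ => sq_nonneg _) (by positivity)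
    have : 0 ≤ K ^ 4 := by positivity
    nlinarith

/-- This bounds the first absolute moment below by the second and fourth ones. With `x = |m|` it
says `0 ≤ x * (r ^ 3 - x * r ^ 2 + x ^ 3)`, clear on either side of `x = r`. -/
theorem sq_div_sub_le_abs (m : ℝ) {r : ℝ} (hr : 0 < r) : m ^ 2 / r - m ^ 4 / r ^ 3 ≤ |m| := by
  have h : m ^ 2 / r - m ^ 4 / r ^ 3 = (m ^ 2 * r ^ 2 - m ^ 4) / r ^ 3 := by
    field_simp
  rw [h, div_le_iff₀ (by positivity), ← sq_abs m, show m ^ 4 = |m| ^ 4 by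
    rw [← abs_pow]; exact (abs_of_nonneg (by positivity)).symm]
  have hx := abs_nonneg m
  have h3 : 0 ≤ r ^ 3 - |m| * r ^ 2 + |m| ^ 3 := by
    rcases le_total |m| r with hle | hle
    · have : 0 ≤ r ^ 2 * (r - |m|) := mul_nonneg (sq_nonneg r) (sub_nonneg.2 hle)
      have : 0 ≤ |m| ^ 3 := by positivity
      linarith
    · have : 0 ≤ |m| * (|m| ^ 2 - r ^ 2) :=
        mul_nonneg hx (sub_nonneg.2 (pow_le_pow_left₀ hr.le hle 2))
      have : 0 ≤ r ^ 3 := by positivity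
      linarith
  linarith [mul_nonneg hx h3]

/-- The mean distance of a nondegenerate centred random walk from its start is unbounded. -/
theorem IsTraffic.tendsto_integral_abs_walk (hA : IsTraffic μ A) {Y : NatMat N → ℝ} {K v : ℝ}
    (h0 : ∀ t, ∫ ω, Y (A t ω) ∂μ = 0) (hK : ∀ t, ∀ᵐ ω ∂μ, |Y (A t ω)| ≤ K) (hv0 : 0 < v)
    (hv : ∀ t, v ≤ ∫ ω, Y (A t ω) ^ 2 ∂μ) :
    Tendsto (fun t : ℕ => ∫ ω, |∑ s ∈ Finset.range t, Y (A s ω)| ∂μ) atTop atTop := by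
  -- At the scale `r = c * √t` both terms of `sq_div_sub_le_abs` are of order `√t`; `c` is large
  -- enough for the second moment to win.
  set c : ℝ := 3 * K ^ 4 / v + 1 with hc
  have hc1 : 1 ≤ c := le_add_of_nonneg_left (by positivity)
  have hcv : 3 * K ^ 4 < v * c ^ 2 := by
    have h1 : v * c = 3 * K ^ 4 + v := by rw [hc]; field_simp
    have h2 : v * c * 1 ≤ v * c * c := by gcongr
    linarith
  have hpos : 0 < v / c - 3 * K ^ 4 / c ^ 3 := by
    have : v / c - 3 * K ^ 4 / c ^ 3 = (v * c ^ 2 - 3 * K ^ 4) / c ^ 3 := by field_simp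
    rw [this]
    exact div_pos (by linarith) (by positivity)
  have hlim : Tendsto (fun t : ℕ => (v / c - 3 * K ^ 4 / c ^ 3) * √(t : ℝ)) atTop atTop :=
    (Real.tendsto_sqrt_atTop.comp tendsto_natCast_atTop_atTop).const_mul_atTop hpos
  refine tendsto_atTop_mono' _ ?_ hlim
  filter_upwards [eventually_gt_atTop 0] with t ht
  have ht' : (0 : ℝ) < t := by exact_mod_cast ht
  have hs : 0 < √(t : ℝ) := Real.sqrt_pos.2 ht'
  have hss : √(t : ℝ) ^ 2 = t := Real.sq_sqrt ht'.le
  have hr : 0 < c * √(t : ℝ) := by positivity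
  obtain ⟨m1, -, m3⟩ := hA.walk_moments h0 hK hv t
  have hint : ∀ k, Integrable (fun ω => (∑ s ∈ Finset.range t, Y (A s ω)) ^ k) μ := fun k =>
    hA.integrable_of_dependsOn (t := t) (F := fun a => (∑ s ∈ Finset.range t, Y (a s)) ^ k)
      fun a a' h => by simp only [dependsOn_sum_range Y t h]
  have hint1 : Integrable (fun ω => |∑ s ∈ Finset.range t, Y (A s ω)|) μ :=
    hA.integrable_of_dependsOn (t := t) (F := fun a => |∑ s ∈ Finset.range t, Y (a s)|)
      fun a a' h => by simp only [dependsOn_sum_range Y t h]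
  have hle := integral_mono (μ := μ)
    (((hint 2).div_const (c * √(t : ℝ))).sub ((hint 4).div_const ((c * √(t : ℝ)) ^ 3))) hint1
    fun ω => sq_div_sub_le_abs (∑ s ∈ Finset.range t, Y (A s ω)) hr
  refine le_trans ?_ hle
  have e : ∫ ω, ((fun ω => (∑ s ∈ Finset.range t, Y (A s ω)) ^ 2 / (c * √(t : ℝ)))
      - fun ω => (∑ s ∈ Finset.range t, Y (A s ω)) ^ 4 / (c * √(t : ℝ)) ^ 3) ω ∂μ
      = (∫ ω, (∑ s ∈ Finset.range t, Y (A s ω)) ^ 2 ∂μ) / (c * √(t : ℝ))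
        - (∫ ω, (∑ s ∈ Finset.range t, Y (A s ω)) ^ 4 ∂μ) / (c * √(t : ℝ)) ^ 3 := by
    simp only [Pi.sub_apply]
    rw [integral_sub ((hint 2).div_const _) ((hint 4).div_const _), integral_div, integral_div]
  rw [e]
  calc (v / c - 3 * K ^ 4 / c ^ 3) * √(t : ℝ)
      = v * √(t : ℝ) ^ 2 / (c * √(t : ℝ))
        - 3 * K ^ 4 * (√(t : ℝ) ^ 2) ^ 2 / (c * √(t : ℝ)) ^ 3 := by
        field_simp
    _ ≤ _ := by
        rw [hss]
        gcongr

end Walk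

/-! ### Rates of conflicting queues -/

section Necessary

variable {N : ℕ} {net : Network N} {S a : ℕ → NatMat N} {K : ℕ}

/-- Positions of which every schedule contains at most one. -/
def IsConflict (E : Finset (Fin N × Fin N)) : Prop :=
  ∀ S : NatMat N, IsSchedule S → ∑ p ∈ E, S p.1 p.2 ≤ 1

theorem isConflict_row (i : Fin N) : IsConflict (Finset.univ.image fun j => (i, j)) :=
  fun S hS => by
    rw [Finset.sum_image fun _ _ _ _ h => (Prod.ext_iff.1 h).2]
    exact hS.row_sum_le i

theorem isConflict_col (j : Fin N) : IsConflict (Finset.univ.image fun i => (i, j)) :=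
  fun S hS => by
    rw [Finset.sum_image fun _ _ _ _ h => (Prod.ext_iff.1 h).1]
    exact hS.col_sum_le j

theorem sum_le_totalLength (E : Finset (Fin N × Fin N)) (L : NatMat N) :
    ∑ p ∈ E, L p.1 p.2 ≤ totalLength L := by
  rw [totalLength, ← Fintype.sum_prod_type' fun i j => L i j]
  exact Finset.sum_le_sum_of_subset (Finset.subset_univ E)

/-- At most one packet per slot leaves the queues in `E`. -/
theorem IsConflict.sum_arrivals_le {E : Finset (Fin N × Fin N)} (hE : IsConflict E)
    (hS : ∀ t, S t ∈ net.feasible) (t : ℕ) :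
    ∑ s ∈ Finset.range t, ∑ p ∈ E, a s p.1 p.2
      ≤ (∑ p ∈ E, (net.run S a t).queue p.1 p.2) + t := by
  induction t with
  | zero => simp
  | succ t ih =>
    have h1 : ∑ p ∈ E, net.departures (net.run S a t) (S t) p.1 p.2 ≤ 1 :=
      (Finset.sum_le_sum fun p _ => Network.departures_le_schedule _ _ _ _).trans
        (hE _ (net.isSchedule _ (hS t)))
    have h2 : ∑ p ∈ E, (net.run S a (t + 1)).queue p.1 p.2
        + ∑ p ∈ E, net.departures (net.run S a t) (S t) p.1 p.2
        = ∑ p ∈ E, (net.run S a t).queue p.1 p.2 + ∑ p ∈ E, a t p.1 p.2 := by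
      rw [← Finset.sum_add_distrib, ← Finset.sum_add_distrib]
      exact Finset.sum_congr rfl fun p _ => Network.run_queue_succ_add hS t p.1 p.2
    rw [Finset.sum_range_succ]
    omega

variable {Ω : Type*} [MeasurableSpace Ω] {μ : Measure Ω} [IsProbabilityMeasure μ]
  {A : ℕ → Ω → NatMat N}

theorem IsTraffic.variance_entry (hA : IsTraffic μ A) (t : ℕ) (p : Fin N × Fin N) :
    Var[fun ω => (A t ω p.1 p.2 : ℝ); μ] = Var[fun ω => (A 0 ω p.1 p.2 : ℝ); μ] :=
  ((hA.identDistrib t p.1 p.2).comp (u := fun n : ℕ => (n : ℝ)) Measurable.of_discrete).variance_eq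

theorem IsTraffic.memLp_eval (hA : IsTraffic μ A) (t : ℕ) (G : NatMat N → ℝ) :
    MemLp (fun ω => G (A t ω)) 2 μ :=
  (memLp_two_iff_integrable_sq (hA.integrable_eval t G).aestronglyMeasurable).2
    (hA.integrable_eval t fun M => G M ^ 2)

/-- By independence over the pairs the variances add, so randomness of one queue in `E` is not
cancelled by the others. -/
theorem IsTraffic.integral_sq_sum (hA : IsTraffic μ A) (E : Finset (Fin N × Fin N)) (t : ℕ) :
    ∫ ω, (∑ p ∈ E, ((A t ω p.1 p.2 : ℝ) - arrivalRate μ A p.1 p.2)) ^ 2 ∂μ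
      = ∑ p ∈ E, Var[fun ω => (A 0 ω p.1 p.2 : ℝ); μ] := by
  have h := IndepFun.variance_sum (μ := μ) (s := E)
    (X := fun (p : Fin N × Fin N) ω => (A t ω p.1 p.2 : ℝ))
    (fun p _ => hA.memLp_eval t fun M => (M p.1 p.2 : ℝ))
    (fun p _ q _ hpq => (hA.indepFun_entry t hpq).comp (Measurable.of_discrete
      (f := fun n : ℕ => (n : ℝ))) (Measurable.of_discrete (f := fun n : ℕ => (n : ℝ))))
  rw [Finset.sum_congr rfl fun p _ => hA.variance_entry t p] at h
  rw [← h, variance_eq_integral (Finset.aemeasurable_sum _ fun p _ =>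
    (hA.integrable_eval t fun M => (M p.1 p.2 : ℝ)).aemeasurable)]
  simp only [Finset.sum_apply]
  rw [integral_finsetSum _ fun p _ => hA.integrable_eval t fun M => (M p.1 p.2 : ℝ)]
  simp only [hA.integral_arrival, Finset.sum_sub_distrib]

theorem SchedulingPolicy.queue_eq (π : SchedulingPolicy net) (t : ℕ) (ω : Ω) :
    π.queue A t ω = (net.run (π.schedule fun τ => A τ ω) (fun τ => A τ ω) t).queue := rfl

theorem IsTraffic.integrable_totalLength (hA : IsTraffic μ A) (π : SchedulingPolicy net) (t : ℕ) :
    Integrable (fun ω => (totalLength (π.queue A t ω) : ℝ)) μ :=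
  hA.integrable_run π t fun x => (totalLength x.queue : ℝ)

theorem IsTraffic.sum_rate_mul_le (hA : IsTraffic μ A) (π : SchedulingPolicy net)
    {E : Finset (Fin N × Fin N)} (hE : IsConflict E) (t : ℕ) :
    (∑ p ∈ E, arrivalRate μ A p.1 p.2 - 1) * t ≤ π.meanLength μ A t := by
  have hi : ∀ s, Integrable (fun ω => ∑ p ∈ E, (A s ω p.1 p.2 : ℝ)) μ := fun s =>
    hA.integrable_eval s fun M => ∑ p ∈ E, (M p.1 p.2 : ℝ)
  have h1 : ∫ ω, (∑ s ∈ Finset.range t, ∑ p ∈ E, (A s ω p.1 p.2 : ℝ)) ∂μ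
      = (∑ p ∈ E, arrivalRate μ A p.1 p.2) * t := by
    rw [integral_finsetSum _ fun s _ => hi s]
    simp only [integral_finsetSum _ fun p _ =>
      hA.integrable_eval _ fun M => (M (p : Fin N × Fin N).1 p.2 : ℝ), hA.integral_arrival]
    simp [mul_comm]
  have h2 : ∫ ω, (∑ s ∈ Finset.range t, ∑ p ∈ E, (A s ω p.1 p.2 : ℝ)) ∂μ
      ≤ ∫ ω, ((totalLength (π.queue A t ω) : ℝ) + t) ∂μ := by
    refine integral_mono (integrable_finsetSum _ fun s _ => hi s)
      ((hA.integrable_totalLength π t).add (integrable_const _)) fun ω => ?_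
    have h3 := hE.sum_arrivals_le (a := fun τ => A τ ω) (π.feasible fun τ => A τ ω) t
    have h4 := sum_le_totalLength E (π.queue A t ω)
    rw [π.queue_eq] at h4
    have h5 : ∑ s ∈ Finset.range t, ∑ p ∈ E, A s ω p.1 p.2
        ≤ totalLength (π.queue A t ω) + t := by
      rw [π.queue_eq]
      omega
    exact_mod_cast h5
  rw [integral_add (hA.integrable_totalLength π t) (integrable_const _), h1] at h2
  simp only [integral_const, probReal_univ, smul_eq_mul, one_mul] at h2
  rw [SchedulingPolicy.meanLength]
  linarith

/-- In a stable network, the rates of conflicting queues add up to less than one, unless their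
arrivals are deterministic. -/
theorem IsTraffic.sum_rate_lt_one_or (hA : IsTraffic μ A) {π : SchedulingPolicy net}
    (hst : StronglyStable π μ A) {E : Finset (Fin N × Fin N)} (hE : IsConflict E) :
    ∑ p ∈ E, arrivalRate μ A p.1 p.2 < 1 ∨ (∑ p ∈ E, arrivalRate μ A p.1 p.2 = 1 ∧
      ∀ p ∈ E, ∀ᵐ ω ∂μ, (A 0 ω p.1 p.2 : ℝ) = arrivalRate μ A p.1 p.2) := by
  have hnot := hA.not_tendsto_meanLength hst
  rcases lt_trichotomy (∑ p ∈ E, arrivalRate μ A p.1 p.2) 1 with h | h | h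
  · exact Or.inl h
  · refine Or.inr ⟨h, fun p hp => ?_⟩
    have hvar : ∑ p ∈ E, Var[fun ω => (A 0 ω p.1 p.2 : ℝ); μ] = 0 := by
      by_contra hne
      refine hnot ?_
      have hpos := lt_of_le_of_ne (Finset.sum_nonneg fun p _ => variance_nonneg _ μ) (Ne.symm hne)
      obtain ⟨K, hK⟩ := hA.ae_bounded
      let Y : NatMat N → ℝ := fun M => ∑ p ∈ E, ((M p.1 p.2 : ℝ) - arrivalRate μ A p.1 p.2)
      have hY0 : ∀ t, ∫ ω, Y (A t ω) ∂μ = 0 := by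
        intro t
        rw [integral_finsetSum _ fun p _ =>
          hA.integrable_eval t fun M => (M p.1 p.2 : ℝ) - arrivalRate μ A p.1 p.2]
        refine Finset.sum_eq_zero fun p _ => ?_
        rw [integral_sub (hA.integrable_eval t fun M => (M p.1 p.2 : ℝ)) (integrable_const _),
          hA.integral_arrival]
        simp
      have hYK : ∀ t, ∀ᵐ ω ∂μ, |Y (A t ω)| ≤ ∑ p ∈ E, ((K : ℝ) + arrivalRate μ A p.1 p.2) := by
        intro t
        filter_upwards [hK] with ω hω
        refine (Finset.abs_sum_le_sum_abs _ _).trans (Finset.sum_le_sum fun p _ => ?_)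
        have h1 : (A t ω p.1 p.2 : ℝ) ≤ K := by exact_mod_cast hω t p.1 p.2
        have h2 := arrivalRate_nonneg (μ := μ) (A := A) p.1 p.2
        have h3 : (0 : ℝ) ≤ A t ω p.1 p.2 := Nat.cast_nonneg _
        rw [abs_le]
        constructor <;> linarith [(Nat.cast_nonneg K : (0 : ℝ) ≤ K)]
      have hlim := hA.tendsto_integral_abs_walk hY0 hYK hpos fun t => (hA.integral_sq_sum E t).ge
      refine tendsto_atTop_mono (fun t => ?_) (hlim.const_mul_atTop (show (0 : ℝ) < 1 / 2 by simp))
      have hiM : Integrable (fun ω => ∑ s ∈ Finset.range t, Y (A s ω)) μ :=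
        hA.integrable_of_dependsOn (dependsOn_sum_range Y t)
      have hi0 : ∫ ω, ∑ s ∈ Finset.range t, Y (A s ω) ∂μ = 0 := by
        rw [integral_finsetSum _ fun s _ => hA.integrable_eval s Y]
        exact Finset.sum_eq_zero fun s _ => hY0 s
      -- The integrand is twice the positive part of the walk, which the total queue dominates. As
      -- the walk is centred, its mean absolute value is twice the mean of its positive part.
      have h1 : ∫ ω, (∑ s ∈ Finset.range t, Y (A s ω) + |∑ s ∈ Finset.range t, Y (A s ω)|) ∂μ
          ≤ ∫ ω, 2 * (totalLength (π.queue A t ω) : ℝ) ∂μ := by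
        refine integral_mono (hiM.add hiM.abs) ((hA.integrable_totalLength π t).const_mul 2)
          fun ω => ?_
        have h3 := hE.sum_arrivals_le (a := fun τ => A τ ω) (π.feasible fun τ => A τ ω) t
        have h4 := sum_le_totalLength E (π.queue A t ω)
        rw [π.queue_eq] at h4
        have h5 : ∑ s ∈ Finset.range t, ∑ p ∈ E, A s ω p.1 p.2
            ≤ totalLength (π.queue A t ω) + t := by
          rw [π.queue_eq]
          omega
        have h6 : ∑ s ∈ Finset.range t, Y (A s ω)
            = (∑ s ∈ Finset.range t, ∑ p ∈ E, (A s ω p.1 p.2 : ℝ)) - t := by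
          simp [Y, Finset.sum_sub_distrib, h]
        have h7 : ∑ s ∈ Finset.range t, Y (A s ω) ≤ totalLength (π.queue A t ω) := by
          rw [h6, sub_le_iff_le_add]
          exact_mod_cast h5
        have h8 : (0 : ℝ) ≤ totalLength (π.queue A t ω) := Nat.cast_nonneg _
        show ∑ s ∈ Finset.range t, Y (A s ω) + |∑ s ∈ Finset.range t, Y (A s ω)|
          ≤ 2 * (totalLength (π.queue A t ω) : ℝ)
        rcases abs_cases (∑ s ∈ Finset.range t, Y (A s ω)) with h9 | h9 <;> linarith
      rw [integral_add hiM hiM.abs, hi0, integral_const_mul] at h1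
      show 1 / 2 * ∫ ω, |∑ s ∈ Finset.range t, Y (A s ω)| ∂μ
        ≤ ∫ ω, (totalLength (π.queue A t ω) : ℝ) ∂μ
      linarith
    have hp0 := (Finset.sum_eq_zero_iff_of_nonneg fun p _ => variance_nonneg _ μ).1 hvar p hp
    rw [variance_eq_integral (hA.integrable_eval 0 fun M => (M p.1 p.2 : ℝ)).aemeasurable] at hp0
    have h2 := (integral_eq_zero_iff_of_nonneg (fun ω => sq_nonneg _)
      (hA.integrable_eval 0 fun M => ((M p.1 p.2 : ℝ) - ∫ ω, (A 0 ω p.1 p.2 : ℝ) ∂μ) ^ 2)).1 hp0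
    filter_upwards [h2] with ω hω
    have := pow_eq_zero_iff two_ne_zero |>.1 hω
    exact sub_eq_zero.1 this
  · refine absurd (tendsto_atTop_mono (hA.sum_rate_mul_le π hE) ?_) hnot
    exact tendsto_natCast_atTop_atTop.const_mul_atTop (sub_pos.2 h)

/-- The constant value is a natural number in the interval from `0` to `1`, and it is not `0`. -/
theorem IsTraffic.ae_eq_one (hA : IsTraffic μ A) {i j : Fin N}
    (h : ∀ᵐ ω ∂μ, (A 0 ω i j : ℝ) = arrivalRate μ A i j) (h0 : arrivalRate μ A i j ≠ 0)
    (h1 : arrivalRate μ A i j ≤ 1) : ∀ᵐ ω ∂μ, ∀ t, A t ω i j = 1 := by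
  refine hA.ae_entry (P := fun n => n = 1) ?_
  filter_upwards [h] with ω hω
  rw [← hω] at h0 h1
  have h2 : A 0 ω i j ≠ 0 := by exact_mod_cast h0
  have h3 : A 0 ω i j ≤ 1 := by exact_mod_cast h1
  omega

end Necessary

/-! ### Stability with a deterministic queue of rate one -/

section Deterministic

variable {N : ℕ} {net : Network N} {S a : ℕ → NatMat N} {K : ℕ}

open Classical in
/-- The number of reconfigurations before slot `t`. -/
noncomputable def reconfigCount (net : Network N) (S a : ℕ → NatMat N) (t : ℕ) : ℕ :=
  ∑ s ∈ Finset.range t, if S s = (net.run S a s).schedule then 0 else 1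

theorem reconfigCount_mono : Monotone (reconfigCount net S a) := fun _ _ h =>
  Finset.sum_le_sum_of_subset (Finset.range_mono h)

theorem Network.blocked_of_ne (hdelay : 0 < net.delay) {x : NetState N} {R : NatMat N}
    (h : R ≠ x.schedule) : net.Blocked x R :=
  (Network.blocked_iff hdelay _ _).2 ⟨0, by simp [NetState.newAge, h], Nat.zero_le _⟩

/-- One packet arrives per slot and at most one leaves, so the packet left behind in a slot of
reconfiguration is never made up for. -/
theorem reconfigCount_le_queue (hdelay : 0 < net.delay) (hS : ∀ t, S t ∈ net.feasible)
    {i j : Fin N} (ha : ∀ t, a t i j = 1) (t : ℕ) :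
    reconfigCount net S a t ≤ (net.run S a t).queue i j := by
  induction t with
  | zero => simp [reconfigCount]
  | succ t ih =>
    have h1 := Network.run_queue_succ_add (a := a) hS t i j
    have h2 := (Network.departures_le_schedule (net := net) (net.run S a t) (S t) i j).trans
      ((net.isSchedule _ (hS t)).le_one i j)
    rw [ha t] at h1
    unfold reconfigCount at ih ⊢
    rw [Finset.sum_range_succ]
    split_ifs with hc
    · omega
    · rw [Network.departures_eq_zero_of_blocked (Network.blocked_of_ne hdelay hc)] at h1
      omega

theorem schedule_eq_of_reconfigCount_eq {t k : ℕ}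
    (h : reconfigCount net S a (t + k) = reconfigCount net S a t) {u : ℕ} (hu : t ≤ u)
    (huk : u < t + k) : S u = S t := by
  induction u, hu using Nat.le_induction with
  | base => rfl
  | succ u hu ih =>
    rw [← ih (by omega)]
    by_contra hne
    -- A change in slot `u + 1` is counted from `u + 2 ≤ t + k` on.
    have h1 : reconfigCount net S a (u + 2) ≤ reconfigCount net S a (t + k) :=
      reconfigCount_mono (by omega)
    have h2 : reconfigCount net S a t ≤ reconfigCount net S a (u + 1) :=
      reconfigCount_mono (by omega)
    have h3 : reconfigCount net S a (u + 2) = reconfigCount net S a (u + 1) + 1 := by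
      unfold reconfigCount
      rw [Finset.sum_range_succ _ (u + 1)]
      rw [if_neg]
      exact hne
    omega

theorem sum_arrivals_le_queue {i j : Fin N} (t k : ℕ)
    (h : ∀ u, t ≤ u → u < t + k → S u i j = 0) :
    ∑ u ∈ Finset.Ico t (t + k), a u i j ≤ (net.run S a (t + k)).queue i j := by
  induction k with
  | zero => simp
  | succ k ih =>
    have h1 := ih fun u h1 h2 => h u h1 (by omega)
    have h2 := Network.departures_le_schedule (net := net) (net.run S a (t + k)) (S (t + k)) i j
    rw [h (t + k) (by omega) (by omega)] at h2
    rw [← add_assoc, Finset.sum_Ico_succ_top (by omega), Network.run_queue_succ]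
    omega

/-- Of two conflicting queues, one is not served as long as the configuration is kept. -/
theorem sum_min_arrivals_le (hS : ∀ t, S t ∈ net.feasible) (ha : ∀ t i j, a t i j ≤ K)
    {p q : Fin N × Fin N} (hpq : p ≠ q)
    (hc : ∀ R : NatMat N, IsSchedule R → R p.1 p.2 + R q.1 q.2 ≤ 1) (t k : ℕ) :
    ∑ u ∈ Finset.Ico t (t + k), min (a u p.1 p.2) (a u q.1 q.2)
      ≤ totalLength (net.run S a (t + k)).queue
        + k * K * (reconfigCount net S a (t + k) - reconfigCount net S a t) := by
  rcases (reconfigCount_mono (net := net) (S := S) (a := a) (Nat.le_add_right t k)).eq_or_lt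
    with h | h
  · have hsum := sum_le_totalLength {p, q} (net.run S a (t + k)).queue
    rw [Finset.sum_pair hpq] at hsum
    have hconst := fun u hu huk => schedule_eq_of_reconfigCount_eq h.symm (u := u) hu huk
    -- The schedule kept in the window misses `p` or `q`; the minimum bounds the arrivals at either.
    have h1 := hc _ (net.isSchedule _ (hS t))
    rcases Nat.eq_zero_or_pos (S t p.1 p.2) with h0 | h0
    · have h2 := sum_arrivals_le_queue (net := net) (S := S) (a := a) (i := p.1) (j := p.2) t k
        fun u hu huk => by rw [hconst u hu huk, h0]
      have h3 : ∑ u ∈ Finset.Ico t (t + k), min (a u p.1 p.2) (a u q.1 q.2)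
        ≤ ∑ u ∈ Finset.Ico t (t + k), a u p.1 p.2 :=
        Finset.sum_le_sum fun u _ => min_le_left _ _
      omega
    · have h0' : S t q.1 q.2 = 0 := by omega
      have h2 := sum_arrivals_le_queue (net := net) (S := S) (a := a) (i := q.1) (j := q.2) t k
        fun u hu huk => by rw [hconst u hu huk, h0']
      have h3 : ∑ u ∈ Finset.Ico t (t + k), min (a u p.1 p.2) (a u q.1 q.2)
        ≤ ∑ u ∈ Finset.Ico t (t + k), a u q.1 q.2 :=
        Finset.sum_le_sum fun u _ => min_le_right _ _
      omega
  -- With a reconfiguration in the window, the last term alone exceeds all arrivals counted.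
  · have h3 : ∑ u ∈ Finset.Ico t (t + k), min (a u p.1 p.2) (a u q.1 q.2)
        ≤ ∑ _u ∈ Finset.Ico t (t + k), K :=
      Finset.sum_le_sum fun u _ => (min_le_left _ _).trans (ha u _ _)
    have h4 : k * K * 1 ≤ k * K * (reconfigCount net S a (t + k) - reconfigCount net S a t) :=
      Nat.mul_le_mul_left _ (by omega)
    simp only [Finset.sum_const, Nat.card_Ico, smul_eq_mul, Nat.add_sub_cancel_left] at h3
    omega

variable {Ω : Type*} [MeasurableSpace Ω] {μ : Measure Ω} [IsProbabilityMeasure μ]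
  {A : ℕ → Ω → NatMat N}

theorem IsTraffic.integral_min_one_pos (hA : IsTraffic μ A) {i j : Fin N}
    (h : arrivalRate μ A i j ≠ 0) : 0 < ∫ ω, ((min (A 0 ω i j) 1 : ℕ) : ℝ) ∂μ := by
  refine lt_of_le_of_ne (integral_nonneg fun _ => Nat.cast_nonneg _) fun h0 => h ?_
  have h1 := (integral_eq_zero_iff_of_nonneg (fun ω => Nat.cast_nonneg _)
    (hA.integrable_eval 0 fun M => ((min (M i j) 1 : ℕ) : ℝ))).1 h0.symm
  have h2 : ∀ᵐ ω ∂μ, (A 0 ω i j : ℝ) = 0 := by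
    filter_upwards [h1] with ω hω
    have h3 : min (A 0 ω i j) 1 = 0 := Nat.cast_eq_zero.1 hω
    have h4 : A 0 ω i j = 0 := by omega
    simp [h4]
  rw [arrivalRate, integral_congr_ae h2]
  simp

/-- Truncation at one replaces the minimum by a product, to which independence applies. -/
theorem IsTraffic.integral_min_arrivals_ge (hA : IsTraffic μ A) {p q : Fin N × Fin N}
    (hpq : p ≠ q) (t : ℕ) :
    (∫ ω, ((min (A 0 ω p.1 p.2) 1 : ℕ) : ℝ) ∂μ) * ∫ ω, ((min (A 0 ω q.1 q.2) 1 : ℕ) : ℝ) ∂μ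
      ≤ ∫ ω, ((min (A t ω p.1 p.2) (A t ω q.1 q.2) : ℕ) : ℝ) ∂μ := by
  have hind := (hA.indepFun_entry t hpq).comp
    (Measurable.of_discrete (f := fun n : ℕ => ((min n 1 : ℕ) : ℝ)))
    (Measurable.of_discrete (f := fun n : ℕ => ((min n 1 : ℕ) : ℝ)))
  have h1 := hind.integral_fun_mul_eq_mul_integral
    (hA.integrable_eval t fun M => ((min (M p.1 p.2) 1 : ℕ) : ℝ)).aestronglyMeasurable
    (hA.integrable_eval t fun M => ((min (M q.1 q.2) 1 : ℕ) : ℝ)).aestronglyMeasurable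
  rw [← hA.integral_entry t p.1 p.2 fun n => ((min n 1 : ℕ) : ℝ),
    ← hA.integral_entry t q.1 q.2 fun n => ((min n 1 : ℕ) : ℝ)]
  refine h1.symm.le.trans (integral_mono
    (hA.integrable_eval t fun M => ((min (M p.1 p.2) 1 : ℕ) : ℝ) * ((min (M q.1 q.2) 1 : ℕ) : ℝ))
    (hA.integrable_eval t fun M => ((min (M p.1 p.2) (M q.1 q.2) : ℕ) : ℝ)) fun ω => ?_)
  have h2 : ∀ m n : ℕ, min m 1 * min n 1 ≤ min m n := by
    intro m n
    rcases Nat.eq_zero_or_pos m with rfl | hm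
    · simp
    rcases Nat.eq_zero_or_pos n with rfl | hn
    · simp
    rw [min_eq_right (Nat.succ_le_of_lt hm), min_eq_right (Nat.succ_le_of_lt hn)]
    exact le_min hm hn
  simp only [Function.comp]
  exact_mod_cast h2 _ _

theorem IsTraffic.integrable_reconfigCount (hA : IsTraffic μ A) (π : SchedulingPolicy net)
    (t : ℕ) : Integrable (fun ω =>
      (reconfigCount net (π.schedule fun τ => A τ ω) (fun τ => A τ ω) t : ℝ)) μ := by
  refine hA.integrable_of_dependsOn (t := t)
    (F := fun a => (reconfigCount net (π.schedule a) a t : ℝ)) fun a a' h => ?_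
  have : reconfigCount net (π.schedule a) a t = reconfigCount net (π.schedule a') a' t := by
    refine Finset.sum_congr rfl fun s hs => ?_
    have hst := Finset.mem_range.1 hs
    have h1 := (π.dependsOn_run s).of_le hst.le h
    simp only at h1
    rw [h1, π.causal a a' s fun τ hτ => h τ (lt_of_le_of_lt hτ hst)]
  simp only [this]

/-- If some queue has deterministic arrivals of rate one, a stabilizing policy can reconfigure the
network only finitely often, so that it cannot serve two conflicting queues. -/
theorem IsTraffic.rate_eq_zero_of_conflict (hA : IsTraffic μ A) (hdelay : 0 < net.delay)
    {π : SchedulingPolicy net} (hst : StronglyStable π μ A) {i j : Fin N}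
    (hdet : ∀ᵐ ω ∂μ, ∀ t, A t ω i j = 1) {p q : Fin N × Fin N} (hpq : p ≠ q)
    (hc : ∀ R : NatMat N, IsSchedule R → R p.1 p.2 + R q.1 q.2 ≤ 1)
    (hp : arrivalRate μ A p.1 p.2 ≠ 0) : arrivalRate μ A q.1 q.2 = 0 := by
  by_contra hq
  refine hA.not_tendsto_meanLength hst ?_
  obtain ⟨K, hK⟩ := hA.ae_bounded
  let n : ℕ → Ω → ℕ := fun t ω => reconfigCount net (π.schedule fun τ => A τ ω) (fun τ => A τ ω) t
  have hn : ∀ t, Integrable (fun ω => (n t ω : ℝ)) μ := hA.integrable_reconfigCount π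
  have hmono : Monotone fun t => ∫ ω, (n t ω : ℝ) ∂μ := fun s t h =>
    integral_mono (hn s) (hn t) fun ω => Nat.cast_le.2 (reconfigCount_mono h)
  have hle : ∀ t, ∫ ω, (n t ω : ℝ) ∂μ ≤ π.meanLength μ A t := by
    intro t
    refine integral_mono_ae (hn t) (hA.integrable_totalLength π t) ?_
    filter_upwards [hdet] with ω hω
    have h1 := reconfigCount_le_queue (a := fun τ => A τ ω) hdelay
      (π.feasible fun τ => A τ ω) hω t
    have h2 := sum_le_totalLength {(i, j)} (π.queue A t ω)
    rw [Finset.sum_singleton, π.queue_eq] at h2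
    rw [π.queue_eq]
    exact_mod_cast h1.trans h2
  -- Either the mean number of reconfigurations diverges, and the mean queue with it, or it
  -- converges, and windows of fixed length contain few of them in the mean.
  rcases tendsto_atTop_of_monotone hmono with htop | ⟨l, hl⟩
  · exact tendsto_atTop_mono hle htop
  set δ := (∫ ω, ((min (A 0 ω p.1 p.2) 1 : ℕ) : ℝ) ∂μ)
    * ∫ ω, ((min (A 0 ω q.1 q.2) 1 : ℕ) : ℝ) ∂μ with hδ
  have hδ0 : 0 < δ := mul_pos (hA.integral_min_one_pos hp) (hA.integral_min_one_pos hq)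
  have hwin : ∀ t k : ℕ, k * δ ≤ π.meanLength μ A (t + k)
      + k * K * ((∫ ω, (n (t + k) ω : ℝ) ∂μ) - ∫ ω, (n t ω : ℝ) ∂μ) := by
    intro t k
    have hi : ∀ u, Integrable (fun ω => ((min (A u ω p.1 p.2) (A u ω q.1 q.2) : ℕ) : ℝ)) μ :=
      fun u => hA.integrable_eval u fun M => ((min (M p.1 p.2) (M q.1 q.2) : ℕ) : ℝ)
    have h1 : ∫ ω, ∑ u ∈ Finset.Ico t (t + k),
        ((min (A u ω p.1 p.2) (A u ω q.1 q.2) : ℕ) : ℝ) ∂μ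
        ≤ ∫ ω, ((totalLength (π.queue A (t + k) ω) : ℝ)
          + k * K * ((n (t + k) ω : ℝ) - n t ω)) ∂μ := by
      refine integral_mono_ae (integrable_finsetSum _ fun u _ => hi u)
        ((hA.integrable_totalLength π _).add (((hn _).sub (hn _)).const_mul _)) ?_
      filter_upwards [hK] with ω hω
      have h2 := sum_min_arrivals_le (a := fun τ => A τ ω) (π.feasible fun τ => A τ ω) hω
        hpq hc t k
      have h3 : n t ω ≤ n (t + k) ω := reconfigCount_mono (Nat.le_add_right t k)
      rw [π.queue_eq, ← Nat.cast_sub h3]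
      exact_mod_cast h2
    have hd : Integrable (fun ω => (n (t + k) ω : ℝ) - n t ω) μ := (hn _).sub (hn _)
    rw [integral_add (hA.integrable_totalLength π _) (hd.const_mul _),
      integral_const_mul, integral_sub (hn _) (hn _), integral_finsetSum _ fun u _ => hi u] at h1
    refine le_trans ?_ h1
    calc (k : ℝ) * δ = ∑ _u ∈ Finset.Ico t (t + k), δ := by simp
      _ ≤ _ := Finset.sum_le_sum fun u _ => hA.integral_min_arrivals_ge hpq u
  rw [tendsto_atTop]
  intro B
  -- The window brings at least `B + 1` packets in the mean; one is given up for reconfigurations.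
  obtain ⟨k, hk⟩ := exists_nat_ge ((B + 1) / δ)
  rw [div_le_iff₀ hδ0] at hk
  have hlim : Tendsto (fun t => (k * K : ℝ) * ((∫ ω, (n (t + k) ω : ℝ) ∂μ)
      - ∫ ω, (n t ω : ℝ) ∂μ)) atTop (𝓝 0) := by
    have := ((hl.comp (tendsto_add_atTop_nat k)).sub hl).const_mul (k * K : ℝ)
    simpa using this
  obtain ⟨t₀, ht₀⟩ := eventually_atTop.1 (hlim.eventually (ge_mem_nhds zero_lt_one))
  refine eventually_atTop.2 ⟨t₀ + k, fun t ht => ?_⟩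
  obtain ⟨s, rfl⟩ : ∃ s, t = s + k := ⟨t - k, by omega⟩
  have h1 := ht₀ s (by omega)
  have h2 := hwin s k
  linarith

end Deterministic

/-! ### Arrivals on a permutation: sample paths -/

section Permutation

variable {N : ℕ} {net : Network N} {g : ℝ → ℝ} {H : ℕ → Equiv.Perm (Fin N)}
  {S a P : ℕ → NatMat N} {K : ℕ} {σ : Equiv.Perm (Fin N)} {I : Finset (Fin N)}

/-- Only the queues `(i, σ i)` with `i ∈ I` are nonzero. -/
def IsSupported (σ : Equiv.Perm (Fin N)) (I : Finset (Fin N)) (L : NatMat N) : Prop :=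
  ∀ i j, L i j ≠ 0 → i ∈ I ∧ σ i = j

/-- All the queues `(i, σ i)` with `i ∈ I` are connected. -/
def Covers (σ : Equiv.Perm (Fin N)) (I : Finset (Fin N)) (R : NatMat N) : Prop :=
  ∀ i ∈ I, R i (σ i) = 1

theorem covers_permMatrix : Covers σ I (σ.permMatrix ℕ) := fun i _ => by
  simp

theorem IsSupported.weight_eq {L : NatMat N} (h : IsSupported σ I L) (R : NatMat N) :
    weight L R = ∑ i ∈ I, L i (σ i) * R i (σ i) := by
  have h1 : ∀ i, ∑ j, L i j * R i j = L i (σ i) * R i (σ i) := fun i =>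
    Finset.sum_eq_single (σ i) (fun j _ hj => by
      by_cases h0 : L i j = 0
      · simp [h0]
      · exact absurd (h i j h0).2.symm hj) (by simp)
  simp only [weight, h1]
  refine (Finset.sum_subset (Finset.subset_univ I) fun i _ hi => ?_).symm
  by_cases h0 : L i (σ i) = 0
  · simp [h0]
  · exact absurd (h i _ h0).1 hi

theorem IsSupported.totalLength_eq {L : NatMat N} (h : IsSupported σ I L) :
    totalLength L = ∑ i ∈ I, L i (σ i) := by
  have := h.weight_eq fun _ _ => 1
  simpa [weight, totalLength] using this

theorem IsSupported.weight_of_covers {L R : NatMat N} (h : IsSupported σ I L)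
    (hR : Covers σ I R) : weight L R = totalLength L := by
  rw [h.weight_eq, h.totalLength_eq]
  exact Finset.sum_congr rfl fun i hi => by rw [hR i hi, mul_one]

theorem IsSupported.weight_add_le {L R : NatMat N} (h : IsSupported σ I L)
    (hR : ∀ i j, R i j ≤ 1) {i : Fin N} (hi : i ∈ I) (h0 : R i (σ i) = 0) :
    weight L R + L i (σ i) ≤ totalLength L := by
  rw [h.weight_eq, h.totalLength_eq, ← Finset.add_sum_erase I _ hi, ← Finset.add_sum_erase I _ hi,
    h0, mul_zero, zero_add, add_comm]
  refine Nat.add_le_add_left (Finset.sum_le_sum fun k _ => ?_) _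
  simpa using Nat.mul_le_mul_left (L k (σ k)) (hR k (σ k))

theorem Network.isSupported_run (ha : ∀ t, IsSupported σ I (a t)) (t : ℕ) :
    IsSupported σ I (net.run S a t).queue := by
  induction t with
  | zero => exact fun i j h => absurd (Network.run_queue_zero i j) h
  | succ t ih =>
    intro i j h
    by_cases h0 : (net.run S a t).queue i j = 0
    · refine ha t i j fun h1 => h ?_
      rw [Network.run_queue_succ, h0, h1, Nat.zero_sub]
    · exact ih i j h0

theorem exists_eq_zero_of_not_covers {R : NatMat N} (hR : IsSchedule R) (h : ¬ Covers σ I R) :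
    ∃ i ∈ I, R i (σ i) = 0 := by
  unfold Covers at h
  push Not at h
  obtain ⟨i, hi, h1⟩ := h
  exact ⟨i, hi, by have := hR.le_one i (σ i); omega⟩

namespace IsAdaptive

/-- A covering schedule weighs as much as all queues together, which no permutation exceeds, and
ties keep the last proposal. -/
theorem covers_proposal_succ (h : IsAdaptive net g H a S P) (ha : ∀ t, IsSupported σ I (a t))
    {t : ℕ} (ht : Covers σ I (P t)) : Covers σ I (P (t + 1)) := by
  have h1 := (Network.isSupported_run (net := net) (S := S) ha (t + 1)).weight_of_covers ht
  have h2 := weight_le_totalLength (L := (net.run S a (t + 1)).queue)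
    (isSchedule_permMatrix (H (t + 1))).le_one
  rw [h.proposal_succ, hamiltonianChoice, if_pos (h1 ▸ h2)]
  exact ht

theorem covers_proposal_of_le (h : IsAdaptive net g H a S P) (ha : ∀ t, IsSupported σ I (a t))
    {s t : ℕ} (hst : s ≤ t) (hs : Covers σ I (P s)) : Covers σ I (P t) := by
  induction t, hst using Nat.le_induction with
  | base => exact hs
  | succ t _ ih => exact h.covers_proposal_succ ha ih

/-- The walk finds the permutation as soon as all its queues are nonempty when it is visited. -/
theorem covers_proposal_of_arrivals (h : IsAdaptive net g H a S P)
    (ha : ∀ t, IsSupported σ I (a t)) {t : ℕ} (hH : H (t + 1) = σ)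
    (hpos : ∀ i ∈ I, 1 ≤ a t i (σ i)) : Covers σ I (P (t + 1)) := by
  by_cases ht : Covers σ I (P t)
  · exact h.covers_proposal_succ ha ht
  obtain ⟨i, hi, h0⟩ := exists_eq_zero_of_not_covers (h.isSchedule t) ht
  have hsupp := Network.isSupported_run (net := net) (S := S) ha (t + 1)
  have h1 := hsupp.weight_of_covers (covers_permMatrix (σ := σ) (I := I))
  have h2 := hsupp.weight_add_le (h.isSchedule t).le_one hi h0
  have h3 : 1 ≤ (net.run S a (t + 1)).queue i (σ i) := by
    have := hpos i hi
    rw [Network.run_queue_succ]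
    omega
  rw [h.proposal_succ, hH, hamiltonianChoice, if_neg (by omega)]
  exact covers_permMatrix

/-- Both weights equal the total queue length, so the gap is zero and never passes the threshold,
even if the two schedules differ outside `I`. -/
theorem eq_of_covers (h : IsAdaptive net g H a S P) (hg : IsHysteresis g)
    (ha : ∀ t, IsSupported σ I (a t)) {t : ℕ} (hP : Covers σ I (P t))
    (hS : Covers σ I (net.run S a t).schedule) : S t = (net.run S a t).schedule := by
  by_contra hne
  have h1 := (h.lt_of_ne hne).2
  have hsupp := Network.isSupported_run (net := net) (S := S) ha t
  rw [hsupp.weight_of_covers hP, hsupp.weight_of_covers hS, sub_self] at h1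
  exact absurd h1 (not_lt.2 (hg.nonneg _ (Nat.cast_nonneg _)))

theorem covers_succ (h : IsAdaptive net g H a S P) (hg : IsHysteresis g)
    (ha : ∀ t, IsSupported σ I (a t)) {t : ℕ} (hP : Covers σ I (P t)) (hS : Covers σ I (S t)) :
    Covers σ I (P (t + 1)) ∧ S (t + 1) = S t := by
  have h1 := h.covers_proposal_succ ha hP
  exact ⟨h1, h.eq_of_covers hg ha h1 hS⟩

/-- If the policy keeps a schedule other than the proposed permutation, some queue has received
few packets. -/
theorem exists_sum_arrivals_le (h : IsAdaptive net g H a S P) (hg : IsHysteresis g)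
    (ha : ∀ t, IsSupported σ I (a t)) (hK : ∀ t i j, a t i j ≤ K) {t s : ℕ} (hts : t ≤ s)
    (hP : Covers σ I (P t)) (hS : ¬ Covers σ I (S s)) :
    ∃ i ∈ I, ((∑ u ∈ Finset.Ico t s, a u i (σ i) : ℕ) : ℝ) ≤ g ((N * N * K * s : ℕ) : ℝ) := by
  -- Backwards in time: a change after slot `t` would install a covering proposal, but the schedule
  -- used at `s` does not cover.
  have hconst : ∀ k, t + k ≤ s → S (s - k) = S s := by
    intro k
    induction k with
    | zero => simp
    | succ k ih =>
      intro hk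
      have h1 := ih (by omega)
      obtain ⟨m, hm⟩ : ∃ m, s - k = m + 1 := ⟨s - k - 1, by omega⟩
      have h2 : s - (k + 1) = m := by omega
      rw [hm] at h1
      rw [h2, ← h1]
      rcases h.eq_or_eq (m + 1) with h3 | h3
      · exact h3.symm
      · refine absurd ?_ hS
        rw [← h1, h3]
        exact h.covers_proposal_of_le ha (by omega) hP
  have hsched := net.isSchedule _ (h.feasible s)
  obtain ⟨i, hi, h0⟩ := exists_eq_zero_of_not_covers hsched hS
  refine ⟨i, hi, ?_⟩
  have h1 := sum_arrivals_le_queue (net := net) (S := S) (a := a) (i := i) (j := σ i) t (s - t)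
    fun u hu hus => by
      have := hconst (s - u) (by omega)
      rw [Nat.sub_sub_self (by omega)] at this
      rw [this, h0]
  rw [Nat.add_sub_cancel' hts] at h1
  have hsupp := Network.isSupported_run (net := net) (S := S) ha s
  have h2 := hsupp.weight_add_le hsched.le_one hi h0
  -- The missed queue is at most the gap between the covering proposal and the schedule, hence at
  -- most the threshold.
  have h3 := h.weight_proposal_sub_le hg s
  rw [hsupp.weight_of_covers (h.covers_proposal_of_le ha hts hP)] at h3
  have h4 := totalLength_run_le (net := net) (S := S) hK s
  have h5 := hg.mono (Nat.cast_nonneg _) (Nat.cast_le (α := ℝ).2 h4)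
  have h6 : ((∑ u ∈ Finset.Ico t s, a u i (σ i) : ℕ) : ℝ)
      ≤ (net.run S a s).queue i (σ i) := Nat.cast_le.2 h1
  have h7 : (weight (net.run S a s).queue (S s) : ℝ) + (net.run S a s).queue i (σ i)
      ≤ totalLength (net.run S a s).queue := by exact_mod_cast h2
  linarith

end IsAdaptive

theorem Network.reconfig_of_newAge {t k : ℕ} (h : (net.run S a t).newAge (S t) = some k) :
    k ≤ t ∧ S (t - k) ≠ (net.run S a (t - k)).schedule := by
  induction t generalizing k with
  | zero =>
    unfold NetState.newAge at h
    split_ifs at h with hc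
    · simp [Network.run, Network.init] at h
    · obtain rfl : 0 = k := Option.some.inj h
      exact ⟨le_rfl, hc⟩
  | succ t ih =>
    unfold NetState.newAge at h
    split_ifs at h with hc
    · obtain ⟨m, hm, rfl⟩ := Option.map_eq_some_iff.1 h
      obtain ⟨h1, h2⟩ := ih hm
      rw [Nat.add_sub_add_right]
      exact ⟨by omega, h2⟩
    · obtain rfl : 0 = k := Option.some.inj h
      exact ⟨Nat.zero_le _, hc⟩

/-! ### Slots without service -/

open Classical in
/-- Indicator of the slots in which the proposal or the schedule misses a queue `(i, σ i)`. -/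
noncomputable def missing (σ : Equiv.Perm (Fin N)) (I : Finset (Fin N)) (S P : ℕ → NatMat N)
    (t : ℕ) : ℕ :=
  if Covers σ I (P t) ∧ Covers σ I (S t) then 0 else 1

/-- The queue with arrivals `x` that is served in every slot. -/
def servedQueue (x : ℕ → ℕ) : ℕ → ℕ
  | 0 => 0
  | t + 1 => servedQueue x t - 1 + x t

theorem sum_range_shift (f : ℕ → ℕ) (k t : ℕ) :
    ∑ s ∈ Finset.range t, (if k ≤ s then f (s - k) else 0) ≤ ∑ s ∈ Finset.range t, f s := by
  have h : ∑ s ∈ Finset.range t, (if k ≤ s then f (s - k) else 0)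
      = ∑ s ∈ Finset.range (t - k), f s := by
    induction t with
    | zero => simp
    | succ t ih =>
      rw [Finset.sum_range_succ, ih]
      split_ifs with hk
      · rw [Nat.sub_add_comm hk, Finset.sum_range_succ]
      · rw [Nat.sub_eq_zero_of_le (by omega), Nat.sub_eq_zero_of_le (by omega)]
        simp
  rw [h]
  exact Finset.sum_le_sum_of_subset (Finset.range_mono (Nat.sub_le t k))

/-- An upper bound of the number of slots in which a queue `(i, σ i)` is not served. -/
noncomputable def lostService (d : ℕ) (b : ℕ → ℕ) (s : ℕ) : ℕ :=
  (if s ≤ d then 1 else 0) + ∑ k ∈ Finset.range (d + 2), if k ≤ s then b (s - k) else 0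

theorem sum_lostService_le (d : ℕ) (b : ℕ → ℕ) (t : ℕ) :
    ∑ s ∈ Finset.range t, lostService d b s
      ≤ (d + 1) + (d + 2) * ∑ s ∈ Finset.range t, b s := by
  simp only [lostService, Finset.sum_add_distrib]
  refine add_le_add ?_ ?_
  · calc ∑ s ∈ Finset.range t, (if s ≤ d then 1 else 0)
        = ((Finset.range t).filter (· ≤ d)).card := by simp
      _ ≤ (Finset.range (d + 1)).card := Finset.card_le_card fun s hs => by
          simp only [Finset.mem_filter, Finset.mem_range] at hs ⊢
          omega
      _ = d + 1 := Finset.card_range _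
  · rw [Finset.sum_comm]
    calc _ ≤ ∑ _k ∈ Finset.range (d + 2), ∑ s ∈ Finset.range t, b s :=
          Finset.sum_le_sum fun k _ => sum_range_shift b k t
      _ = _ := by simp

namespace IsAdaptive

theorem departures_eq_one (h : IsAdaptive net g H a S P) (hg : IsHysteresis g)
    (hdelay : 0 < net.delay) (ha : ∀ t, IsSupported σ I (a t)) {i : Fin N} (hi : i ∈ I) {t : ℕ}
    (hlost : lostService ⌊net.delay⌋₊ (missing σ I S P) t = 0)
    (hq : (net.run S a t).queue i (σ i) ≠ 0) :
    net.departures (net.run S a t) (S t) i (σ i) = 1 := by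
  simp only [lostService, Nat.add_eq_zero_iff, Finset.sum_eq_zero_iff, Finset.mem_range,
    ite_eq_right_iff, one_ne_zero, imp_false, not_le] at hlost
  obtain ⟨hd, hmiss⟩ := hlost
  have hgood : ∀ k < ⌊net.delay⌋₊ + 2, k ≤ t →
      Covers σ I (P (t - k)) ∧ Covers σ I (S (t - k)) := by
    intro k hk hkt
    by_contra hc
    have := hmiss k hk hkt
    simp [missing, hc] at this
  -- A reconfiguration at `t - k` with `k ≤ d` is excluded by coverage in the slot before it, so the
  -- window has `d + 2` slots. The first `d + 1` slots are written off so that this earlier slot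
  -- exists.
  have hb : ¬ net.Blocked (net.run S a t) (S t) := by
    rw [Network.blocked_iff hdelay]
    rintro ⟨k, hk, hkd⟩
    obtain ⟨hkt, hne⟩ := Network.reconfig_of_newAge hk
    obtain ⟨m, hm⟩ : ∃ m, t - k = m + 1 := ⟨t - k - 1, by omega⟩
    obtain ⟨h1, h2⟩ := hgood (k + 1) (by omega) (by omega)
    rw [show t - (k + 1) = m by omega] at h1 h2
    rw [hm] at hne
    exact hne (h.covers_succ hg ha h1 h2).2
  have h1 := Network.queue_mul_departures hb i (σ i)
  have h2 := (hgood 0 (by omega) (Nat.zero_le _)).2 i hi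
  rw [Nat.sub_zero] at h2
  rw [h2] at h1
  exact Nat.eq_of_mul_eq_mul_left (Nat.pos_of_ne_zero hq) h1

/-- Compared with permanent service, each lost slot costs at most one packet. -/
theorem queue_le_servedQueue (h : IsAdaptive net g H a S P) (hg : IsHysteresis g)
    (hdelay : 0 < net.delay) (ha : ∀ t, IsSupported σ I (a t)) {i : Fin N} (hi : i ∈ I) (t : ℕ) :
    (net.run S a t).queue i (σ i) ≤ servedQueue (fun t => a t i (σ i)) t
      + ∑ s ∈ Finset.range t, lostService ⌊net.delay⌋₊ (missing σ I S P) s := by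
  induction t with
  | zero => simp [Network.run_queue_zero]
  | succ t ih =>
    rw [Finset.sum_range_succ, servedQueue, Network.run_queue_succ]
    by_cases hq : (net.run S a t).queue i (σ i) = 0
    · omega
    · rcases Nat.eq_zero_or_pos (lostService ⌊net.delay⌋₊ (missing σ I S P) t) with h0 | h0
      · rw [h.departures_eq_one hg hdelay ha hi h0 hq]
        omega
      · omega

open Classical in
/-- The proposal or the schedule misses a queue only if the arrivals are exceptional. -/
theorem missing_le (h : IsAdaptive net g H a S P) (hg : IsHysteresis g)
    (hH : IsHamiltonianWalk H) (ha : ∀ t, IsSupported σ I (a t)) (hK : ∀ t i j, a t i j ≤ K)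
    {v : ℕ} (hv : v < N !) (hHv : H (v + 1) = σ) (s : ℕ) :
    (missing σ I S P s : ℝ)
      ≤ ∏ u ∈ (Finset.range (s / (2 * N !))).image (fun k => v + N ! * k),
          (if ∀ i ∈ I, 1 ≤ a u i (σ i) then (0 : ℝ) else 1)
        + ∑ i ∈ I, Real.exp (g ((N * N * K * s : ℕ) : ℝ))
          * ∏ u ∈ Finset.Ico (s / 2) s, Real.exp (-(a u i (σ i) : ℝ)) := by
  have h1 : 0 ≤ ∏ u ∈ (Finset.range (s / (2 * N !))).image (fun k => v + N ! * k),
      (if ∀ i ∈ I, 1 ≤ a u i (σ i) then (0 : ℝ) else 1) :=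
    Finset.prod_nonneg fun u _ => by split_ifs <;> simp
  have h2 : ∀ i ∈ I, 0 ≤ Real.exp (g ((N * N * K * s : ℕ) : ℝ))
      * ∏ u ∈ Finset.Ico (s / 2) s, Real.exp (-(a u i (σ i) : ℝ)) := fun i _ =>
    mul_nonneg (Real.exp_nonneg _) (Finset.prod_nonneg fun _ _ => Real.exp_nonneg _)
  have h3 := Finset.sum_nonneg h2
  unfold missing
  split_ifs with hc
  · rw [Nat.cast_zero]
    exact add_nonneg h1 h3
  rw [Nat.cast_one]
  -- The first half of the slots up to `s` is for the walk: if a visit to `σ` follows a slot with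
  -- arrivals at all of `I`, the proposal covers from `s / 2` on. A miss at `s` is then the
  -- schedule's, and some queue got at most the threshold in the second half, which makes its
  -- exponential term at least one. Without such a visit the first product equals one.
  by_cases hex : ∃ u ∈ (Finset.range (s / (2 * N !))).image (fun k => v + N ! * k),
      ∀ i ∈ I, 1 ≤ a u i (σ i)
  · obtain ⟨u, hu, hpos⟩ := hex
    obtain ⟨k, hk, rfl⟩ := Finset.mem_image.1 hu
    rw [Finset.mem_range, ← Nat.div_div_eq_div_mul] at hk
    have hle : v + N ! * k + 1 ≤ s / 2 := by
      have h4 : N ! * (k + 1) ≤ N ! * (s / 2 / N !) := Nat.mul_le_mul_left _ hk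
      have h5 := Nat.mul_div_le (s / 2) (N !)
      rw [Nat.mul_succ] at h4
      omega
    have hHu : H (v + N ! * k + 1) = σ := by
      rw [add_right_comm, hH.apply_add_mul, hHv]
    have hP := h.covers_proposal_of_le ha hle (h.covers_proposal_of_arrivals ha hHu hpos)
    have hS : ¬ Covers σ I (S s) := fun hS =>
      hc ⟨h.covers_proposal_of_le ha (Nat.div_le_self s 2) hP, hS⟩
    obtain ⟨i, hi, hle2⟩ := h.exists_sum_arrivals_le hg ha hK (Nat.div_le_self s 2) hP hS
    have h4 : (1 : ℝ) ≤ Real.exp (g ((N * N * K * s : ℕ) : ℝ))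
        * ∏ u ∈ Finset.Ico (s / 2) s, Real.exp (-(a u i (σ i) : ℝ)) := by
      rw [← Real.exp_sum, ← Real.exp_add, Real.one_le_exp_iff, Finset.sum_neg_distrib]
      rw [Nat.cast_sum] at hle2
      linarith
    have h5 := Finset.single_le_sum h2 hi
    linarith
  · have : ∏ u ∈ (Finset.range (s / (2 * N !))).image (fun k => v + N ! * k),
        (if ∀ i ∈ I, 1 ≤ a u i (σ i) then (0 : ℝ) else 1) = 1 :=
      Finset.prod_eq_one fun u hu => if_neg fun hpos => hex ⟨u, hu, hpos⟩
    rw [this]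
    linarith

end IsAdaptive

end Permutation

/-! ### Arrivals on a permutation: stability -/

section PermutationStability

variable {N : ℕ} {net : Network N} {Ω : Type*} [MeasurableSpace Ω] {μ : Measure Ω}
  [IsProbabilityMeasure μ] {A : ℕ → Ω → NatMat N} {σ : Equiv.Perm (Fin N)} {I : Finset (Fin N)}

theorem IsTraffic.integral_prod_slots (hA : IsTraffic μ A) (G : NatMat N → ℝ) (T : Finset ℕ) :
    ∫ ω, ∏ u ∈ T, G (A u ω) ∂μ = ∏ u ∈ T, ∫ ω, G (A u ω) ∂μ := by
  induction T using Finset.induction_on_max with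
  | empty => simp
  | insert t T hT ih =>
    have ht : t ∉ T := fun h => lt_irrefl t (hT t h)
    simp only [Finset.prod_insert ht]
    have h := hA.integral_mul (t := t) (F := fun a => ∏ u ∈ T, G (a u))
      (fun a a' h => Finset.prod_congr rfl fun u hu => by rw [h u (hT u hu)]) G
    rw [← ih, mul_comm, ← h]
    simp only [mul_comm]

theorem IsTraffic.integrable_prod_slots (hA : IsTraffic μ A) (G : NatMat N → ℝ) (T : Finset ℕ) :
    Integrable (fun ω => ∏ u ∈ T, G (A u ω)) μ := by
  refine hA.integrable_of_dependsOn (t := T.sup id + 1) (F := fun a => ∏ u ∈ T, G (a u))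
    fun a a' h => Finset.prod_congr rfl fun u hu => ?_
  rw [h u (Nat.lt_succ_of_le (Finset.le_sup (f := id) hu))]

/-- This is the base of the Chernoff bound for queues with few arrivals; it rests on `exp (-n) ≤ 1 -
(1 - exp (-1)) * min n 1`. -/
theorem IsTraffic.integral_exp_neg_lt_one (hA : IsTraffic μ A) {i j : Fin N}
    (h : arrivalRate μ A i j ≠ 0) :
    0 < ∫ ω, Real.exp (-(A 0 ω i j : ℝ)) ∂μ ∧ ∫ ω, Real.exp (-(A 0 ω i j : ℝ)) ∂μ < 1 := by
  have hi := hA.integrable_eval 0 fun M => Real.exp (-(M i j : ℝ))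
  refine ⟨integral_exp_pos hi, ?_⟩
  have hm := hA.integrable_eval 0 fun M => ((min (M i j) 1 : ℕ) : ℝ)
  have h1 : ∫ ω, Real.exp (-(A 0 ω i j : ℝ)) ∂μ
      ≤ ∫ ω, (1 - (1 - Real.exp (-1)) * ((min (A 0 ω i j) 1 : ℕ) : ℝ)) ∂μ := by
    refine integral_mono hi ((integrable_const _).sub (hm.const_mul _)) fun ω => ?_
    show Real.exp (-(A 0 ω i j : ℝ)) ≤ 1 - (1 - Real.exp (-1)) * ((min (A 0 ω i j) 1 : ℕ) : ℝ)
    rcases Nat.eq_zero_or_pos (A 0 ω i j) with h0 | h0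
    · simp [h0]
    · rw [min_eq_right (Nat.succ_le_of_lt h0)]
      have : (1 : ℝ) ≤ A 0 ω i j := by exact_mod_cast h0
      have := Real.exp_le_exp.2 (neg_le_neg this)
      push_cast
      linarith
  rw [integral_sub (integrable_const _) (hm.const_mul _), integral_const_mul] at h1
  have h2 := hA.integral_min_one_pos h
  have h3 : Real.exp (-1) < 1 := Real.exp_lt_one_iff.2 (by norm_num)
  have h4 := mul_pos (sub_pos.2 h3) h2
  simp only [integral_const, probReal_univ, smul_eq_mul, one_mul] at h1
  linarith

open Classical in
/-- With positive probability, packets arrive at all the queues `(i, σ i)` in the same slot. -/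
theorem IsTraffic.exists_integral_miss_le (hA : IsTraffic μ A)
    (hI : ∀ i ∈ I, arrivalRate μ A i (σ i) ≠ 0) :
    ∃ r : ℝ, 0 < r ∧ r < 1 ∧ ∀ t,
      ∫ ω, (if ∀ i ∈ I, 1 ≤ A t ω i (σ i) then (0 : ℝ) else 1) ∂μ ≤ r := by
  set δ := ∏ i : I, ∫ ω, ((min (A 0 ω i (σ i)) 1 : ℕ) : ℝ) ∂μ with hδ
  have hδ0 : 0 < δ := Finset.prod_pos fun i _ => hA.integral_min_one_pos (hI i i.2)
  -- The maximum keeps the ratio positive when the arrivals are certain and `δ = 1`.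
  refine ⟨max (1 - δ) (1 / 2), by positivity, max_lt (by linarith) (by norm_num), fun t =>
    le_max_of_le_left ?_⟩
  have hind : iIndepFun (fun (i : I) ω => ((min (A t ω i (σ i)) 1 : ℕ) : ℝ)) μ := by
    have h1 := hA.indep.precomp (g := fun i : I => (t, (i : Fin N), σ i)) fun i j hij => by
      simpa using hij
    exact h1.comp (fun _ n => ((min n 1 : ℕ) : ℝ)) fun _ => Measurable.of_discrete
  have h1 := hind.integral_fun_prod_eq_prod_integral fun i =>
    (hA.integrable_eval t fun M => ((min (M i (σ i)) 1 : ℕ) : ℝ)).aestronglyMeasurable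
  have h2 : ∏ i : I, ∫ ω, ((min (A t ω i (σ i)) 1 : ℕ) : ℝ) ∂μ = δ :=
    Finset.prod_congr rfl fun i _ => hA.integral_entry t i (σ i) fun n => ((min n 1 : ℕ) : ℝ)
  rw [h2] at h1
  have h3 : ∀ ω, (if ∀ i ∈ I, 1 ≤ A t ω i (σ i) then (0 : ℝ) else 1)
      = 1 - ∏ i : I, ((min (A t ω i (σ i)) 1 : ℕ) : ℝ) := by
    intro ω
    split_ifs with hc
    · rw [Finset.prod_eq_one fun i _ => by rw [min_eq_right (hc i i.2), Nat.cast_one], sub_self]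
    · push Not at hc
      obtain ⟨i, hi, h0⟩ := hc
      rw [Finset.prod_eq_zero (Finset.mem_univ (⟨i, hi⟩ : I)), sub_zero]
      have : A t ω i (σ i) = 0 := by omega
      simp [this]
  simp only [h3]
  rw [integral_sub (integrable_const _)
    (hA.integrable_eval t fun M => ∏ i : I, ((min (M i (σ i)) 1 : ℕ) : ℝ)), h1]
  simp

theorem summable_pow_div {r : ℝ} (h0 : 0 < r) (h1 : r < 1) {m : ℕ} (hm : 0 < m) :
    Summable fun s : ℕ => r ^ (s / m) := by
  set x := r ^ ((m : ℝ)⁻¹) with hx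
  have hx0 : 0 < x := Real.rpow_pos_of_pos h0 _
  have hx1 : x < 1 := Real.rpow_lt_one h0.le h1 (by positivity)
  have hxm : x ^ m = r := Real.rpow_inv_natCast_pow h0.le hm.ne'
  refine Summable.of_nonneg_of_le (fun s => by positivity) (fun s => ?_)
    ((summable_geometric_of_lt_one hx0.le hx1).mul_right (x ^ m)⁻¹)
  rw [← div_eq_mul_inv, le_div_iff₀ (by positivity), ← hxm, ← pow_mul, ← pow_add]
  refine pow_le_pow_of_le_one hx0.le hx1.le ?_
  have h2 := Nat.div_add_mod s m
  have h3 := Nat.mod_lt s hm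
  omega

/-- With `ρ = exp (-4 * κ)` the power is at most `exp (-2 * κ * s)`, and sublinearity of `g` costs
only `exp (κ * s + G)`. -/
theorem summable_exp_mul_pow {g : ℝ → ℝ} (hg : IsHysteresis g) (c : ℕ) {ρ : ℝ} (h0 : 0 < ρ)
    (h1 : ρ < 1) :
    Summable fun s : ℕ => Real.exp (g ((c * s : ℕ) : ℝ)) * ρ ^ (s - s / 2) := by
  set κ := -Real.log ρ / 4 with hκ
  have hκ0 : 0 < κ := by
    have := Real.log_neg h0 h1
    rw [hκ]
    linarith
  obtain ⟨G, -, hG⟩ := hg.exists_le_linear (show 0 < κ / (c + 1) by positivity)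
  have hx1 : Real.exp (-κ) < 1 := Real.exp_lt_one_iff.2 (by linarith)
  refine Summable.of_nonneg_of_le (fun s => by positivity) (fun s => ?_)
    ((summable_geometric_of_lt_one (Real.exp_nonneg _) hx1).mul_left (Real.exp G))
  have hρ : ρ = Real.exp (-4 * κ) := by
    rw [hκ, show -4 * (-Real.log ρ / 4) = Real.log ρ by ring, Real.exp_log h0]
  have h2 := hG ((c * s : ℕ) : ℝ) (Nat.cast_nonneg _)
  have h3 : κ / (c + 1) * ((c * s : ℕ) : ℝ) ≤ κ * s := by
    push_cast
    rw [div_mul_eq_mul_div, div_le_iff₀ (by positivity)]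
    have : 0 ≤ κ * s := by positivity
    nlinarith
  have h4 : (s : ℝ) ≤ 2 * ((s - s / 2 : ℕ) : ℝ) := by
    exact_mod_cast (by omega : s ≤ 2 * (s - s / 2))
  rw [hρ, ← Real.exp_nat_mul, ← Real.exp_nat_mul, ← Real.exp_add, ← Real.exp_add]
  refine Real.exp_le_exp.2 ?_
  nlinarith

/-- The mean number of slots in which the policy misses one of the queues is finite. -/
theorem IsTraffic.exists_sum_missing_le (hA : IsTraffic μ A) {g : ℝ → ℝ} (hg : IsHysteresis g)
    {H : ℕ → Equiv.Perm (Fin N)} (hH : IsHamiltonianWalk H)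
    (hI : ∀ i ∈ I, arrivalRate μ A i (σ i) ≠ 0) (K : ℕ) :
    ∃ (C : ℝ) (B : ℕ → Ω → ℝ), (∀ s, Integrable (B s) μ) ∧
      (∀ t, ∑ s ∈ Finset.range t, ∫ ω, B s ω ∂μ ≤ C) ∧
      ∀ ω S P, IsAdaptive net g H (fun τ => A τ ω) S P →
        (∀ t, IsSupported σ I (A t ω)) → (∀ t i j, A t ω i j ≤ K) →
        ∀ s, (missing σ I S P s : ℝ) ≤ B s ω := by
  classical
  -- The slot before a visit to `σ` matters, as its arrivals must fill the queues. A visit in slot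
  -- `0` is replaced by its repetition in slot `N !`.
  obtain ⟨v, hv, hHv⟩ : ∃ v < N !, H (v + 1) = σ := by
    obtain ⟨t, ⟨ht, hHt⟩, -⟩ := hH.visits σ
    rcases Nat.eq_zero_or_pos t with rfl | hpos
    · have := Nat.factorial_pos N
      refine ⟨(N !) - 1, by omega, ?_⟩
      rw [Nat.sub_add_cancel this, ← hHt, ← hH.periodic 0, zero_add]
    · exact ⟨t - 1, by omega, by rwa [Nat.sub_add_cancel hpos]⟩
  obtain ⟨r, hr0, hr1, hr⟩ := hA.exists_integral_miss_le hI
  let T : ℕ → Finset ℕ := fun s => (Finset.range (s / (2 * N !))).image fun k => v + N ! * k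
  let miss : NatMat N → ℝ := fun M => if ∀ i ∈ I, 1 ≤ M i (σ i) then (0 : ℝ) else 1
  let E : Fin N → NatMat N → ℝ := fun i M => Real.exp (-(M i (σ i) : ℝ))
  let q : Fin N → ℝ := fun i => ∫ ω, Real.exp (-(A 0 ω i (σ i) : ℝ)) ∂μ
  let p : ℕ → ℝ := fun s => r ^ (s / (2 * N !))
    + ∑ i ∈ I, Real.exp (g ((N * N * K * s : ℕ) : ℝ)) * q i ^ (s - s / 2)
  have hq := fun i hi => hA.integral_exp_neg_lt_one (hI i hi)
  have hp0 : ∀ s, 0 ≤ p s := fun s => add_nonneg (by positivity) (Finset.sum_nonneg fun i hi =>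
    mul_nonneg (Real.exp_nonneg _) (pow_nonneg (hq i hi).1.le _))
  have hp : Summable p := (summable_pow_div hr0 hr1 (by positivity)).add
    (summable_sum fun i hi => summable_exp_mul_pow hg (N * N * K) (hq i hi).1 (hq i hi).2)
  have hi1 : ∀ s, Integrable (fun ω => ∏ u ∈ T s, miss (A u ω)) μ := fun s =>
    hA.integrable_prod_slots miss (T s)
  have hi2 : ∀ s i, Integrable (fun ω => Real.exp (g ((N * N * K * s : ℕ) : ℝ))
      * ∏ u ∈ Finset.Ico (s / 2) s, E i (A u ω)) μ := fun s i =>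
    (hA.integrable_prod_slots (E i) _).const_mul _
  refine ⟨∑' s, p s, fun s ω => ∏ u ∈ T s, miss (A u ω) + ∑ i ∈ I,
    Real.exp (g ((N * N * K * s : ℕ) : ℝ)) * ∏ u ∈ Finset.Ico (s / 2) s, E i (A u ω),
    fun s => (hi1 s).add (integrable_finsetSum _ fun i _ => hi2 s i), fun t => ?_,
    fun ω S P h ha hK s => h.missing_le hg hH ha hK hv hHv s⟩
  refine le_trans (Finset.sum_le_sum fun s _ => ?_) (hp.sum_le_tsum _ fun s _ => hp0 s)
  rw [integral_add (hi1 s) (integrable_finsetSum _ fun i _ => hi2 s i),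
    integral_finsetSum _ fun i _ => hi2 s i]
  refine add_le_add ?_ (Finset.sum_le_sum fun i _ => ?_)
  · have hcard : (T s).card = s / (2 * N !) := by
      rw [Finset.card_image_of_injective, Finset.card_range]
      intro k l hkl
      exact Nat.eq_of_mul_eq_mul_left (Nat.factorial_pos N) (Nat.add_left_cancel hkl)
    rw [hA.integral_prod_slots, ← hcard, ← Finset.prod_const]
    exact Finset.prod_le_prod (fun u _ => integral_nonneg fun ω => by
      simp only [miss]; split_ifs <;> simp) fun u _ => hr u
  · rw [integral_const_mul, hA.integral_prod_slots]
    refine mul_le_mul_of_nonneg_left (le_of_eq ?_) (Real.exp_nonneg _)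
    rw [Finset.prod_congr rfl fun u _ => hA.integral_entry u i (σ i) fun n => Real.exp (-(n : ℝ)),
      Finset.prod_const, Nat.card_Ico]

theorem IsTraffic.integrable_servedQueue (hA : IsTraffic μ A) (i j : Fin N) (t : ℕ)
    (f : ℕ → ℝ) : Integrable (fun ω => f (servedQueue (fun t => A t ω i j) t)) μ := by
  refine hA.integrable_of_dependsOn (t := t)
    (F := fun a => f (servedQueue (fun t => a t i j) t)) fun a a' h => ?_
  have : ∀ s ≤ t, servedQueue (fun t => a t i j) s = servedQueue (fun t => a' t i j) s := by
    intro s hs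
    induction s with
    | zero => rfl
    | succ s ih =>
      rw [servedQueue, servedQueue, ih (by omega), h s (by exact hs)]
  simp only [this t le_rfl]

/-- A queue that is served in every slot is stable if its arrivals have rate less than one, or are
deterministic with rate one. -/
theorem IsTraffic.exists_sum_servedQueue_le (hA : IsTraffic μ A) {i j : Fin N}
    (h : arrivalRate μ A i j < 1 ∨ ∀ᵐ ω ∂μ, ∀ t, A t ω i j = 1) :
    ∃ C : ℝ, ∀ t : ℕ, ∑ τ ∈ Finset.range t,
      ∫ ω, (servedQueue (fun t => A t ω i j) τ : ℝ) ∂μ ≤ C * t := by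
  have hi : ∀ t (f : ℕ → ℝ), Integrable (fun ω => f (servedQueue (fun t => A t ω i j) t)) μ :=
    hA.integrable_servedQueue i j
  rcases h with hlt | hdet
  · obtain ⟨K, hK⟩ := hA.ae_bounded
    set m := arrivalRate μ A i j with hm
    have hdrift : ∀ t, (∫ ω, (servedQueue (fun t => A t ω i j) (t + 1) : ℝ) ^ 2 ∂μ)
        + 2 * (1 - m) * ∫ ω, (servedQueue (fun t => A t ω i j) t : ℝ) ∂μ
        ≤ (∫ ω, (servedQueue (fun t => A t ω i j) t : ℝ) ^ 2 ∂μ) + ((K : ℝ) + 1) ^ 2 := by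
      intro t
      have hcross : ∫ ω, (servedQueue (fun t => A t ω i j) t : ℝ) * ((A t ω i j : ℝ) - 1) ∂μ
          = (∫ ω, (servedQueue (fun t => A t ω i j) t : ℝ) ∂μ) * (m - 1) := by
        have h1 : ∫ ω, ((A t ω i j : ℝ) - 1) ∂μ = m - 1 := by
          rw [integral_sub (hA.integrable_eval t fun M => (M i j : ℝ)) (integrable_const _),
            hA.integral_arrival]
          simp [hm]
        rw [← h1]
        refine hA.integral_mul (F := fun a => (servedQueue (fun t => a t i j) t : ℝ))
          (fun a a' h => ?_) fun M => (M i j : ℝ) - 1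
        have : ∀ s ≤ t, servedQueue (fun t => a t i j) s = servedQueue (fun t => a' t i j) s := by
          intro s hs
          induction s with
          | zero => rfl
          | succ s ih => rw [servedQueue, servedQueue, ih (by omega), h s (by exact hs)]
        simp only [this t le_rfl]
      have hci : Integrable (fun ω => (servedQueue (fun t => A t ω i j) t : ℝ)
          * ((A t ω i j : ℝ) - 1)) μ := by
        refine (hA.integrable_eval t fun M => (M i j : ℝ) - 1).bdd_mul (c := (K * t : ℝ))
          (hi t fun n => (n : ℝ)).aestronglyMeasurable ?_
        filter_upwards [hK] with ω hω
        have h4 : servedQueue (fun t => A t ω i j) t ≤ K * t := by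
          clear hcross
          induction t with
          | zero => simp [servedQueue]
          | succ t ih =>
            have := hω t i j
            rw [servedQueue, Nat.mul_succ]
            omega
        rw [Real.norm_of_nonneg (Nat.cast_nonneg _)]
        exact_mod_cast h4
      have h1 := integral_mono_ae (μ := μ)
        (f := fun ω => (servedQueue (fun t => A t ω i j) (t + 1) : ℝ) ^ 2)
        (g := fun ω => (servedQueue (fun t => A t ω i j) t : ℝ) ^ 2 + ((K : ℝ) + 1) ^ 2
          + 2 * ((servedQueue (fun t => A t ω i j) t : ℝ) * ((A t ω i j : ℝ) - 1)))
        (hi (t + 1) fun n => (n : ℝ) ^ 2)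
        (((hi t fun n => (n : ℝ) ^ 2).add (integrable_const _)).add (hci.const_mul 2)) (by
          filter_upwards [hK] with ω hω
          have hle : (A t ω i j : ℝ) ≤ K := by exact_mod_cast hω t i j
          have hnn : (0 : ℝ) ≤ A t ω i j := Nat.cast_nonneg _
          rw [servedQueue]
          -- At an empty queue `0 - 1 = 0`, so the new square is that of the arrivals, within `(K +
          -- 1) ^ 2`.
          rcases Nat.eq_zero_or_pos (servedQueue (fun t => A t ω i j) t) with h0 | h0
          · simp only [h0]
            push_cast
            nlinarith
          · rw [Nat.cast_add, Nat.cast_sub h0]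
            push_cast
            nlinarith)
      rw [integral_add (f := fun ω => (servedQueue (fun t => A t ω i j) t : ℝ) ^ 2
          + ((K : ℝ) + 1) ^ 2) ((hi t fun n => (n : ℝ) ^ 2).add (integrable_const _))
          (hci.const_mul 2), integral_add (hi t fun n => (n : ℝ) ^ 2) (integrable_const _),
        integral_const_mul, hcross] at h1
      simp only [integral_const, probReal_univ, smul_eq_mul, one_mul] at h1
      linarith
    have hsum := sum_le_of_drift
      (V := fun t => ∫ ω, (servedQueue (fun t => A t ω i j) t : ℝ) ^ 2 ∂μ)
      (fun t => integral_nonneg fun ω => sq_nonneg _) hdrift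
    have hpos : 0 < 2 * (1 - m) := by linarith
    refine ⟨((K : ℝ) + 1) ^ 2 / (2 * (1 - m)), fun t => ?_⟩
    rw [div_mul_eq_mul_div, le_div_iff₀' hpos]
    refine (hsum t).trans (le_of_eq ?_)
    simp [servedQueue]
  · refine ⟨1, fun t => ?_⟩
    calc ∑ τ ∈ Finset.range t, ∫ ω, (servedQueue (fun t => A t ω i j) τ : ℝ) ∂μ
        ≤ ∑ _τ ∈ Finset.range t, (1 : ℝ) := by
          refine Finset.sum_le_sum fun τ _ => ?_
          calc ∫ ω, (servedQueue (fun t => A t ω i j) τ : ℝ) ∂μ ≤ ∫ _ω, (1 : ℝ) ∂μ := by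
                refine integral_mono_ae (hi τ fun n => (n : ℝ)) (integrable_const _) ?_
                filter_upwards [hdet] with ω hω
                have : ∀ τ, servedQueue (fun t => A t ω i j) τ ≤ 1 := by
                  intro τ
                  induction τ with
                  | zero => simp [servedQueue]
                  | succ τ ih =>
                    simp only [servedQueue, hω τ]
                    omega
                exact_mod_cast this τ
            _ = 1 := by simp
      _ = 1 * t := by simp

/-- The adaptive Hamiltonian policy stabilizes the network if all arrivals are at the queues of a
permutation, each of which is stable when served in every slot. -/
theorem stronglyStable_of_isSupported (hA : IsTraffic μ A)
    (hnet : net.NonBlocking) (hdelay : 0 < net.delay) {g : ℝ → ℝ} (hg : IsHysteresis g)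
    {H : ℕ → Equiv.Perm (Fin N)} (hH : IsHamiltonianWalk H) {P₀ : NatMat N}
    (hP₀ : P₀ ∈ net.feasible) (hsupp : ∀ i j, arrivalRate μ A i j ≠ 0 → σ i = j)
    (hrate : ∀ i, arrivalRate μ A i (σ i) < 1 ∨ ∀ᵐ ω ∂μ, ∀ t, A t ω i (σ i) = 1) :
    StronglyStable (AdaptiveHamiltonian.policy g H hnet hP₀) μ A := by
  classical
  set π := AdaptiveHamiltonian.policy g H hnet hP₀ with hπ
  set I := Finset.univ.filter fun i => arrivalRate μ A i (σ i) ≠ 0 with hIdef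
  have hI : ∀ i ∈ I, arrivalRate μ A i (σ i) ≠ 0 := fun i hi => (Finset.mem_filter.1 hi).2
  obtain ⟨K, hK⟩ := hA.ae_bounded
  have hS : ∀ᵐ ω ∂μ, ∀ t, IsSupported σ I (A t ω) := by
    have h1 : ∀ᵐ ω ∂μ, ∀ i j, arrivalRate μ A i j = 0 → ∀ t, A t ω i j = 0 := by
      refine ae_all_iff.2 fun i => ae_all_iff.2 fun j => ?_
      by_cases h0 : arrivalRate μ A i j = 0
      · filter_upwards [hA.ae_eq_zero_of_arrivalRate_eq_zero h0] with ω hω _ using hω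
      · exact Eventually.of_forall fun ω h => absurd h h0
    filter_upwards [h1] with ω hω t i j hij
    have h2 : arrivalRate μ A i j ≠ 0 := fun h => hij (hω i j h t)
    have h3 := hsupp i j h2
    exact ⟨Finset.mem_filter.2 ⟨Finset.mem_univ i, h3 ▸ h2⟩, h3⟩
  obtain ⟨C, B, hBint, hBsum, hB⟩ := hA.exists_sum_missing_le (net := net) hg hH hI K
  choose c hc using fun i => hA.exists_sum_servedQueue_le (hrate i)
  set d := ⌊net.delay⌋₊
  have hmi : ∀ i t, Integrable (fun ω => (servedQueue (fun t => A t ω i (σ i)) t : ℝ)) μ :=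
    fun i t => hA.integrable_servedQueue i (σ i) t fun n => n
  -- The excess over the permanently served queues is bounded uniformly in `t`, because the mean
  -- number of missing slots is finite.
  have hmean : ∀ t, π.meanLength μ A t ≤ ∑ i ∈ I,
      ((∫ ω, (servedQueue (fun t => A t ω i (σ i)) t : ℝ) ∂μ)
        + ((d + 1) + (d + 2) * C)) := by
    intro t
    have hBi : Integrable (fun ω => ∑ s ∈ Finset.range t, B s ω) μ :=
      integrable_finsetSum _ fun s _ => hBint s
    have hni : Integrable (fun ω => ((d : ℝ) + 1) + (d + 2) * ∑ s ∈ Finset.range t, B s ω) μ :=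
      (integrable_const _).add (hBi.const_mul _)
    calc π.meanLength μ A t
        ≤ ∫ ω, ∑ i ∈ I, ((servedQueue (fun t => A t ω i (σ i)) t : ℝ)
          + (((d : ℝ) + 1) + (d + 2) * ∑ s ∈ Finset.range t, B s ω)) ∂μ := by
          refine integral_mono_ae (hA.integrable_totalLength π t)
            (integrable_finsetSum _ fun i _ => (hmi i t).add hni) ?_
          filter_upwards [hK, hS] with ω hKω hSω
          have had := AdaptiveHamiltonian.isAdaptive g H hnet hP₀ fun τ => A τ ω
          have h1 : ((∑ s ∈ Finset.range t, lostService d (missing σ I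
              (AdaptiveHamiltonian.schedule net g H P₀ fun τ => A τ ω) fun t =>
              (AdaptiveHamiltonian.closedLoop net g H P₀ (fun τ => A τ ω) (t + 1)).2) s : ℕ) : ℝ)
              ≤ ((d : ℝ) + 1) + (d + 2) * ∑ s ∈ Finset.range t, B s ω := by
            refine (Nat.cast_le.2 (sum_lostService_le d _ t)).trans ?_
            push_cast
            gcongr with s _
            exact hB ω _ _ had hSω hKω s
          have h2 := (Network.isSupported_run (net := net)
            (S := AdaptiveHamiltonian.schedule net g H P₀ fun τ => A τ ω) hSω t).totalLength_eq
          show (totalLength (net.run (AdaptiveHamiltonian.schedule net g H P₀ fun τ => A τ ω)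
            (fun τ => A τ ω) t).queue : ℝ) ≤ _
          rw [h2, Nat.cast_sum]
          refine Finset.sum_le_sum fun i hi => ?_
          have h3 := had.queue_le_servedQueue hg hdelay hSω hi t
          refine (Nat.cast_le.2 h3).trans ?_
          rw [Nat.cast_add]
          exact add_le_add le_rfl h1
      _ = ∑ i ∈ I, ((∫ ω, (servedQueue (fun t => A t ω i (σ i)) t : ℝ) ∂μ)
          + (((d : ℝ) + 1) + (d + 2) * ∑ s ∈ Finset.range t, ∫ ω, B s ω ∂μ)) := by
          have hsi : ∀ i, Integrable (fun ω => (servedQueue (fun t => A t ω i (σ i)) t : ℝ)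
              + (((d : ℝ) + 1) + (d + 2) * ∑ s ∈ Finset.range t, B s ω)) μ :=
            fun i => (hmi i t).add hni
          rw [integral_finsetSum _ fun i _ => hsi i]
          refine Finset.sum_congr rfl fun i _ => ?_
          rw [integral_add (hmi i t) hni, integral_add (integrable_const _) (hBi.const_mul _),
            integral_const_mul, integral_finsetSum _ fun s _ => hBint s]
          simp
      _ ≤ _ := by
          gcongr with i _
          exact hBsum t
  refine hA.stronglyStable_of_sum_le π
    (C := ∑ i ∈ I, |c i + ((d + 1) + (d + 2) * C)|) fun t => ?_
  calc ∑ τ ∈ Finset.range t, π.meanLength μ A τ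
      ≤ ∑ τ ∈ Finset.range t, ∑ i ∈ I,
        ((∫ ω, (servedQueue (fun t => A t ω i (σ i)) τ : ℝ) ∂μ) + ((d + 1) + (d + 2) * C)) :=
        Finset.sum_le_sum fun τ _ => hmean τ
    _ = ∑ i ∈ I, ((∑ τ ∈ Finset.range t,
        ∫ ω, (servedQueue (fun t => A t ω i (σ i)) τ : ℝ) ∂μ)
          + t * ((d + 1) + (d + 2) * C)) := by
        rw [Finset.sum_comm]
        refine Finset.sum_congr rfl fun i _ => ?_
        rw [Finset.sum_add_distrib, Finset.sum_const, Finset.card_range, nsmul_eq_mul]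
    _ ≤ ∑ i ∈ I, |c i + ((d + 1) + (d + 2) * C)| * (t + 1) := by
        refine Finset.sum_le_sum fun i _ => ?_
        have ht : (0 : ℝ) ≤ t := Nat.cast_nonneg t
        have h1 := hc i t
        have h2 := mul_le_mul_of_nonneg_right (le_abs_self (c i + ((d + 1) + (d + 2) * C))) ht
        have h3 := abs_nonneg (c i + ((d + 1) + (d + 2) * C))
        linarith
    _ = _ := by rw [Finset.sum_mul]

end PermutationStability

/-! ### Throughput optimality -/

section Optimality

variable {N : ℕ} {net : Network N} {Ω : Type*} [MeasurableSpace Ω] {μ : Measure Ω}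
  [IsProbabilityMeasure μ] {A : ℕ → Ω → NatMat N}

theorem sum_row_image {α : Type*} [AddCommMonoid α] (f : Fin N → Fin N → α) (i : Fin N) :
    ∑ p ∈ Finset.univ.image (fun j => (i, j)), f p.1 p.2 = ∑ j, f i j :=
  Finset.sum_image fun _ _ _ _ h => (Prod.ext_iff.1 h).2

theorem sum_col_image {α : Type*} [AddCommMonoid α] (f : Fin N → Fin N → α) (j : Fin N) :
    ∑ p ∈ Finset.univ.image (fun i => (i, j)), f p.1 p.2 = ∑ i, f i j :=
  Finset.sum_image fun _ _ _ _ h => (Prod.ext_iff.1 h).1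

/-- Finitely many strict inequalities share a slack; arguing with small `ε` also covers `N = 0`. -/
theorem exists_pos_forall_le_one_sub (x : Fin N → ℝ) (h : ∀ i, x i < 1) :
    ∃ ε, 0 < ε ∧ ε < 1 ∧ ∀ i, x i ≤ 1 - ε := by
  have h1 : ∀ᶠ ε in 𝓝[>] (0 : ℝ), ∀ i, x i ≤ 1 - ε := by
    refine eventually_all.2 fun i => ?_
    filter_upwards [Ioo_mem_nhdsGT (sub_pos.2 (h i))] with ε hε
    linarith [hε.2]
  obtain ⟨ε, h2, h3⟩ := (h1.and (Ioo_mem_nhdsGT (zero_lt_one (α := ℝ)))).exists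
  exact ⟨ε, h3.1, h3.2, h2⟩

/-- In a stable network in which the rates of some conflicting queues add up to one, the queues
with arrivals lie on a permutation. -/
theorem IsTraffic.exists_perm_of_sum_eq_one (hA : IsTraffic μ A) (hdelay : 0 < net.delay)
    {π : SchedulingPolicy net} (hst : StronglyStable π μ A) {E : Finset (Fin N × Fin N)}
    (h1 : ∑ p ∈ E, arrivalRate μ A p.1 p.2 = 1)
    (hE : ∀ p ∈ E, ∀ᵐ ω ∂μ, (A 0 ω p.1 p.2 : ℝ) = arrivalRate μ A p.1 p.2) :
    ∃ σ : Equiv.Perm (Fin N), ∀ i j, arrivalRate μ A i j ≠ 0 → σ i = j := by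
  classical
  obtain ⟨p, hp, hp0⟩ := Finset.exists_ne_zero_of_sum_ne_zero (h1.trans_ne one_ne_zero)
  have hp1 : arrivalRate μ A p.1 p.2 ≤ 1 := h1 ▸ Finset.single_le_sum
    (f := fun p : Fin N × Fin N => arrivalRate μ A p.1 p.2)
    (fun _ _ => arrivalRate_nonneg _ _) hp
  have hdet := hA.ae_eq_one (hE p hp) hp0 hp1
  -- The pattern of positive rates is a schedule: two such queues in one line would conflict, which
  -- the deterministic queue of rate one excludes.
  let R : NatMat N := fun i j => if arrivalRate μ A i j = 0 then 0 else 1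
  have hR : IsSchedule R := by
    refine ⟨fun i j => ?_, fun i => ?_, fun j => ?_⟩
    · simp only [R]
      split_ifs <;> simp
    · by_contra hlt
      obtain ⟨j, -, k, -, hj, hk, hjk⟩ : ∃ j ∈ Finset.univ, ∃ k ∈ Finset.univ,
          R i j ≠ 0 ∧ R i k ≠ 0 ∧ j ≠ k := by
        have hcard : 1 < (Finset.univ.filter fun j => R i j ≠ 0).card := by
          simpa [R, Finset.sum_ite, Finset.filter_not] using hlt
        obtain ⟨j, k, hj, hk, hjk⟩ := Finset.one_lt_card_iff.1 hcard
        exact ⟨j, Finset.mem_univ _, k, Finset.mem_univ _, (Finset.mem_filter.1 hj).2,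
          (Finset.mem_filter.1 hk).2, hjk⟩
      have hj' : arrivalRate μ A i j ≠ 0 := fun h => hj (if_pos h)
      refine hk (if_pos (hA.rate_eq_zero_of_conflict hdelay hst hdet (p := (i, j)) (q := (i, k))
        (by simpa using hjk) (fun S hS => ?_) hj'))
      rw [← Finset.sum_pair (f := fun j => S i j) hjk]
      exact (Finset.sum_le_sum_of_subset (Finset.subset_univ _)).trans (hS.row_sum_le i)
    · by_contra hlt
      obtain ⟨i, -, k, -, hi, hk, hik⟩ : ∃ i ∈ Finset.univ, ∃ k ∈ Finset.univ,
          R i j ≠ 0 ∧ R k j ≠ 0 ∧ i ≠ k := by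
        have hcard : 1 < (Finset.univ.filter fun i => R i j ≠ 0).card := by
          simpa [R, Finset.sum_ite, Finset.filter_not] using hlt
        obtain ⟨i, k, hi, hk, hik⟩ := Finset.one_lt_card_iff.1 hcard
        exact ⟨i, Finset.mem_univ _, k, Finset.mem_univ _, (Finset.mem_filter.1 hi).2,
          (Finset.mem_filter.1 hk).2, hik⟩
      have hi' : arrivalRate μ A i j ≠ 0 := fun h => hi (if_pos h)
      refine hk (if_pos (hA.rate_eq_zero_of_conflict hdelay hst hdet (p := (i, j)) (q := (k, j))
        (by simpa using hik) (fun S hS => ?_) hi'))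
      rw [← Finset.sum_pair (f := fun i => S i j) hik]
      exact (Finset.sum_le_sum_of_subset (Finset.subset_univ _)).trans (hS.col_sum_le j)
  obtain ⟨σ, hσ⟩ := exists_perm_of_isSchedule hR
  exact ⟨σ, fun i j h => hσ i j (by simp [R, h])⟩

/-- In a stable network, every rate is less than one, or the arrivals are deterministic with
rate one. -/
theorem IsTraffic.rate_lt_one_or (hA : IsTraffic μ A) {π : SchedulingPolicy net}
    (hst : StronglyStable π μ A) (i j : Fin N) :
    arrivalRate μ A i j < 1 ∨ ∀ᵐ ω ∂μ, ∀ t, A t ω i j = 1 := by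
  have hle : arrivalRate μ A i j ≤ ∑ j, arrivalRate μ A i j :=
    Finset.single_le_sum (f := fun j => arrivalRate μ A i j)
      (fun _ _ => arrivalRate_nonneg _ _) (Finset.mem_univ j)
  rcases hA.sum_rate_lt_one_or hst (isConflict_row i) with h | ⟨h1, h2⟩
  · rw [sum_row_image] at h
    exact Or.inl (hle.trans_lt h)
  · rw [sum_row_image] at h1
    by_cases h0 : arrivalRate μ A i j = 0
    · exact Or.inl (h0 ▸ zero_lt_one)
    · exact Or.inr (hA.ae_eq_one (h2 (i, j) (Finset.mem_image_of_mem _ (Finset.mem_univ j))) h0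
        (hle.trans h1.le))

end Optimality

theorem corollary2 {N : ℕ} (net : Network N) (hnet : net.NonBlocking) (hdelay : 0 < net.delay)
    (g : ℝ → ℝ) (hg : IsHysteresis g)
    (H : ℕ → Equiv.Perm (Fin N)) (hH : IsHamiltonianWalk H)
    (P₀ : NatMat N) (hP₀ : P₀ ∈ net.feasible) :
    ThroughputOptimal.{u} (AdaptiveHamiltonian.policy g H hnet hP₀) := by
  rintro Ω _ μ _ A hA ⟨π, hst⟩
  -- This settles the boundary of the capacity region; the cases below reach it from any line whose
  -- rates do not add up to less than one.
  have hperm : ∀ E : Finset (Fin N × Fin N), ∑ p ∈ E, arrivalRate μ A p.1 p.2 = 1 →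
      (∀ p ∈ E, ∀ᵐ ω ∂μ, (A 0 ω p.1 p.2 : ℝ) = arrivalRate μ A p.1 p.2) →
      StronglyStable (AdaptiveHamiltonian.policy g H hnet hP₀) μ A := fun E h1 h2 => by
    obtain ⟨σ, hσ⟩ := hA.exists_perm_of_sum_eq_one hdelay hst h1 h2
    exact stronglyStable_of_isSupported hA hnet hdelay hg hH hP₀ hσ
      fun i => hA.rate_lt_one_or hst i (σ i)
  by_cases hrow : ∀ i, ∑ j, arrivalRate μ A i j < 1
  · by_cases hcol : ∀ j, ∑ i, arrivalRate μ A i j < 1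
    · obtain ⟨ε, hε, hε1, hr⟩ := exists_pos_forall_le_one_sub _ hrow
      obtain ⟨η, hη, -, hc⟩ := exists_pos_forall_le_one_sub _ hcol
      exact stronglyStable_of_rate_le hA hnet hdelay hg hH hP₀ (lt_min hε hη)
        (min_lt_of_left_lt hε1) (fun i => (hr i).trans (sub_le_sub_left (min_le_left _ _) _))
        fun j => (hc j).trans (sub_le_sub_left (min_le_right _ _) _)
    · push Not at hcol
      obtain ⟨j, hj⟩ := hcol
      rcases hA.sum_rate_lt_one_or hst (isConflict_col j) with h | ⟨h1, h2⟩
      · rw [sum_col_image] at h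
        exact absurd h (not_lt.2 hj)
      · exact hperm _ h1 h2
  · push Not at hrow
    obtain ⟨i, hi⟩ := hrow
    rcases hA.sum_rate_lt_one_or hst (isConflict_row i) with h | ⟨h1, h2⟩
    · rw [sum_row_image] at h
      exact absurd h (not_lt.2 hi)
    · exact hperm _ h1 h2
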